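/- All graphs are finite, simple and undirected; $e(G)$ is the number of edges of $G$, and a $k$-edge-connected graph has at least two vertices when $k\ge 2$. For $k\ge 2$, an edge-coloring of $G$ (adjacent edges may share a color) is an $MC_k$-coloring if every two distinct vertices of $G$ are connected by at least $k$ pairwise edge-disjoint monochromatic paths (different paths may have different colors); $mc_k(G)$ is the maximum number of colors used by an $MC_k$-coloring of $G$. A minimal $k$-edge-connected spanning subgraph of $G$ is a $k$-edge-connected spanning subgraph from which no edge can be deleted without destroying $k$-edge-connectedness; a minimum one is a minimal one with the fewest edges. The formula $$mc_k(G)=e(G)-e(H)+\left\lfloor \tfrac{k}{2}\right\rfloor \quad\text{for every minimum $k$-edge-connected spanning subgraph $H$ of $G$}$$ holds in each of the following cases. 1. $k=2$ and $G$ is any $2$-edge-connected graph; that is, $mc_2(G)=e(G)-e(H)+1$. 2. $k=2n$ with $n\ge 2$ and $G=K_{2n+1}$. This graph is $2n$-edge-connected, and $mc_{2n}(K_{2n+1})=n$. 3. $G=K_{k,n}$ with $n\ge k$, where either $k\ge 4$ is even or $k=3$. This graph is $k$-edge-connected, and $mc_k(K_{k,n})=k/2$ if $k\ge 4$ is even,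 while $mc_3(K_{3,n})=1$. -/

import Mathlib

namespace SimpleGraph

/-- A walk is monochromatic for the edge-coloring `Γ` if any two of its edges have the same color. -/
def IsMonochromatic {V C : Type*} {G : SimpleGraph V} (Γ : G.edgeSet → C) {u v : V}
    (p : G.Walk u v) : Prop :=
  ∀ e f : G.edgeSet, (e : Sym2 V) ∈ p.edges → (f : Sym2 V) ∈ p.edges → Γ e = Γ f

/-- `Γ` is a monochromatic `k`-edge-connection coloring: every two distinct vertices are joined by
`k` pairwise edge-disjoint monochromatic paths (different paths may have different colors). -/
def IsMCColoring {V C : Type*} {G : SimpleGraph V} (k : ℕ) (Γ : G.edgeSet → C) : Prop :=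
  ∀ u v : V, u ≠ v → ∃ P : Fin k → G.Path u v,
    (∀ i, IsMonochromatic Γ (P i : G.Walk u v)) ∧
    ∀ i j, i ≠ j → List.Disjoint (P i : G.Walk u v).edges (P j : G.Walk u v).edges

/-- The numbers `r` of colors such that some monochromatic `k`-edge-connection coloring of `G`
uses exactly `r` colors. -/
def mcColorCounts {V : Type*} (G : SimpleGraph V) (k : ℕ) : Set ℕ :=
  {r | ∃ Γ : G.edgeSet → Fin r, Function.Surjective Γ ∧ IsMCColoring k Γ}

/-- The monochromatic `k`-edge-connection number `mc_k(G)`: the maximum number of colors in a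
monochromatic `k`-edge-connection coloring (see `mc_isGreatest`). -/
noncomputable def mc {V : Type*} (G : SimpleGraph V) (k : ℕ) : ℕ :=
  sSup (mcColorCounts G k)

/-- On a finite graph that has a monochromatic `k`-edge-connection coloring, the supremum defining
`mc_k(G)` is a maximum. -/
theorem mc_isGreatest {V : Type*} [Finite V] (G : SimpleGraph V) (k : ℕ)
    (h : (mcColorCounts G k).Nonempty) : IsGreatest (mcColorCounts G k) (mc G k) := by
  have hb : BddAbove (mcColorCounts G k) := by
    refine ⟨Nat.card G.edgeSet, ?_⟩
    rintro r ⟨Γ, hΓ, -⟩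
    simpa using Nat.card_le_card_of_surjective Γ hΓ
  exact ⟨Nat.sSup_mem h hb, fun _ hr => le_csSup hb hr⟩

/-- The number of edges `e(G)` of a finite graph. -/
noncomputable def numEdges {V : Type*} (G : SimpleGraph V) : ℕ := G.edgeSet.ncard

/-- `H` is a minimal `k`-edge-connected spanning subgraph of `G`: it is `k`-edge-connected, and no
edge of it can be deleted without destroying this property. -/
def IsMinimalECSpanning {V : Type*} (G : SimpleGraph V) (k : ℕ) (H : SimpleGraph V) : Prop :=
  H ≤ G ∧ H.IsEdgeConnected k ∧ ∀ e ∈ H.edgeSet, ¬ (H.deleteEdges {e}).IsEdgeConnected k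

/-- `H` is a minimum `k`-edge-connected spanning subgraph of `G`: a minimal one with the smallest
number of edges. -/
def IsMinimumECSpanning {V : Type*} (G : SimpleGraph V) (k : ℕ) (H : SimpleGraph V) : Prop :=
  IsMinimalECSpanning G k H ∧
    ∀ H' : SimpleGraph V, IsMinimalECSpanning G k H' → numEdges H ≤ numEdges H'

/-- The formula `mc_k(G) = e(G) - e(H) + ⌊k/2⌋` for every minimum `k`-edge-connected spanning
subgraph `H` of `G`. -/
def MCFormula {V : Type*} (G : SimpleGraph V) (k : ℕ) : Prop :=
  ∀ H : SimpleGraph V, IsMinimumECSpanning G k H →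
    (mc G k : ℤ) = (numEdges G : ℤ) - (numEdges H : ℤ) + ((k / 2 : ℕ) : ℤ)

end SimpleGraph

/-! Case `k = 2`. Coloring a minimum `H` with one color and every other edge with a color of its own
gives the lower bound, because two vertices of a 2-edge-connected graph are joined by two
edge-disjoint paths. For the upper bound, split the color classes of an `r`-coloring into connected
classes `C i`, at least `r` in number. It suffices to find a 2-edge-connected spanning subgraph with
at most `1 + ∑ (e(C i) - 1)` edges (`IsClassSystem.exists_isEdgeConnected_two`).

Start from a class `S` with the largest vertex set `U`. The ends of a bridge of `S` are joined in
another class `C i`, and the bridge is charged to `i`. Bridges form a forest, so at most `|A i| - 1`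
are charged to `i`, where `A i` is the set of vertices of `C i` in `U`. Beyond one edge, `C i` can
afford `|A i| - 2` edges and roughly one more per vertex outside `U`; maximality of `U` lets every
outside vertex collect at least two (`IsClassSystem.sum_le`). Outside vertices are absorbed by ears,
`w` inner vertices costing `w + 1 ≤ 2w` edges, and each surviving bridge is repaired by one edge.

A deficit of one occurs only if exactly `|A i| - 1` bridges are charged to `i`. If `C i` has an edge
inside `U`, adding it destroys two of these bridges. Otherwise `C i` contains an ear of `U`; unless
the edges inside `U` already destroyed one of these bridges, an ear can be chosen that bypasses one.
Either that bridge gets bypassed, or the vertices of the ear have a spare unit that covers the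
deficit. The delicate point is two crossing ears, where one path along both bypasses both bridges
(`exists_separated_by_both`, `EarBudget.exists_larger`).

Other cases. Every edge has an end of degree `k`. The `k` paths leaving such a vertex use all its
edges, so no color has smaller degree elsewhere. Color degree one would force a spanning
monochromatic star, which is impossible; hence `2r ≤ k`. By degrees, `G` is its own only
`k`-edge-connected spanning subgraph. For the lower bound, Hamiltonian cycles provide `k / 2`
classes that are 2-edge-connected; for `K_{3,n}` one color is enough. -/

namespace SimpleGraph

variable {V : Type*}

/-! ### Walks and single edge deletions -/

/-- Deleting the edge `xy` leaves a vertex connected to `x` connected to one of `x`, `y`. -/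
lemma Reachable.deleteEdges_or {S : SimpleGraph V} {a x : V} (h : S.Reachable a x) (y : V) :
    (S.deleteEdges {s(x, y)}).Reachable a x ∨ (S.deleteEdges {s(x, y)}).Reachable a y := by
  obtain ⟨p⟩ := h
  induction p with
  | nil => exact Or.inl .rfl
  | @cons u v w h p ih =>
    by_cases he : s(u, v) = s(w, y)
    · rcases Sym2.eq_iff.1 he with ⟨rfl, -⟩ | ⟨rfl, -⟩
      · exact Or.inl .rfl
      · exact Or.inr .rfl
    · have hadj : (S.deleteEdges {s(w, y)}).Adj u v :=
        deleteEdges_adj.2 ⟨h, he⟩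
      exact ih.imp hadj.reachable.trans hadj.reachable.trans

/-- Deleting one edge from a connected graph leaves at most two parts. -/
lemma Reachable.deleteEdges_three {S : SimpleGraph V} {u v w : V} (huv : S.Reachable u v)
    (huw : S.Reachable u w) (e : Sym2 V) :
    (S.deleteEdges {e}).Reachable u v ∨ (S.deleteEdges {e}).Reachable u w ∨
      (S.deleteEdges {e}).Reachable v w := by
  induction e with
  | _ x y =>
  by_cases hux : S.Reachable u x
  · have h1 := hux.deleteEdges_or y
    have h2 := (huv.symm.trans hux).deleteEdges_or y
    have h3 := (huw.symm.trans hux).deleteEdges_or y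
    rcases h1 with h1 | h1 <;> rcases h2 with h2 | h2 <;> rcases h3 with h3 | h3
    all_goals first
      | exact Or.inl (h1.trans h2.symm)
      | exact Or.inr (Or.inl (h1.trans h3.symm))
      | exact Or.inr (Or.inr (h2.trans h3.symm))
  · left
    obtain ⟨p⟩ := huv
    refine (p.toDeleteEdge s(x, y) fun he => hux ?_).reachable
    classical
    exact ⟨p.takeUntil x (p.fst_mem_support_of_mem_edges he)⟩

/-- If `e` is not a bridge, deleting it does not change reachability. -/
lemma Reachable.deleteEdges_of_not_isBridge {S : SimpleGraph V} {e : Sym2 V} (he : ¬ S.IsBridge e)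
    {u v : V} (h : S.Reachable u v) : (S.deleteEdges {e}).Reachable u v := by
  induction e with
  | _ x y =>
  have hxy : (S.deleteEdges {s(x, y)}).Reachable x y := by
    by_contra hc
    exact he hc
  by_cases hux : S.Reachable u x
  · have h1 := hux.deleteEdges_or y
    have h2 := (h.symm.trans hux).deleteEdges_or y
    have key : ∀ w, ((S.deleteEdges {s(x, y)}).Reachable w x ∨
        (S.deleteEdges {s(x, y)}).Reachable w y) → (S.deleteEdges {s(x, y)}).Reachable w x :=
      fun w hw => hw.elim id fun hw => hw.trans hxy.symm
    exact (key _ h1).trans (key _ h2).symm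
  · obtain ⟨p⟩ := h
    refine (p.toDeleteEdge s(x, y) fun he => hux ?_).reachable
    classical
    exact ⟨p.takeUntil x (p.fst_mem_support_of_mem_edges he)⟩

/-- An edge of a trail splits it into two parts that avoid the edge. -/
lemma Walk.IsTrail.reachable_deleteEdges {S : SimpleGraph V} {c d : V} {p : S.Walk c d}
    (hp : p.IsTrail) {x y : V} (he : s(x, y) ∈ p.edges) :
    ((S.deleteEdges {s(x, y)}).Reachable c x ∧ (S.deleteEdges {s(x, y)}).Reachable y d) ∨
    ((S.deleteEdges {s(x, y)}).Reachable c y ∧ (S.deleteEdges {s(x, y)}).Reachable x d) := by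
  induction p with
  | nil => simp at he
  | @cons u v w h p ih =>
    rw [isTrail_cons] at hp
    by_cases h' : s(x, y) = s(u, v)
    · have hr : (S.deleteEdges {s(x, y)}).Reachable v w :=
        (p.toDeleteEdge _ (by rw [h']; exact hp.2)).reachable
      rcases Sym2.eq_iff.1 h' with ⟨rfl, rfl⟩ | ⟨rfl, rfl⟩
      · exact Or.inl ⟨.rfl, hr⟩
      · exact Or.inr ⟨.rfl, hr⟩
    · have hadj : (S.deleteEdges {s(x, y)}).Adj u v :=
        deleteEdges_adj.2 ⟨h, fun hc => h' (Set.mem_singleton_iff.1 hc).symm⟩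
      have he' : s(x, y) ∈ p.edges := by
        simpa [h'] using he
      exact (ih hp.1 he').imp (And.imp_left hadj.reachable.trans)
        (And.imp_left hadj.reachable.trans)

/-- A walk that enters a set has an initial path outside of it, followed by an edge into it. -/
lemma Walk.exists_isPath_until {S : SimpleGraph V} {z t : V} (p : S.Walk z t) {T : Set V}
    (hz : z ∉ T) (ht : t ∈ T) :
    ∃ z' x, x ∈ T ∧ S.Adj z' x ∧ ∃ q : S.Walk z z', q.IsPath ∧
      ∀ y ∈ q.support, y ∉ T ∧ y ∈ p.support := by
  classical
  induction p with
  | nil => exact absurd ht hz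
  | @cons u v w h p ih =>
    by_cases hv : v ∈ T
    · exact ⟨u, v, hv, h, Walk.nil, by simp, by simp [hz]⟩
    · obtain ⟨z', x, hx, hadj, q, -, hs⟩ := ih hv ht
      refine ⟨z', x, hx, hadj, (q.cons h).bypass, bypass_isPath _, fun y hy => ?_⟩
      have := support_bypass_subset_support _ hy
      simp only [support_cons, List.mem_cons] at this ⊢
      rcases this with rfl | this
      · exact ⟨hz, Or.inl rfl⟩
      · exact ⟨(hs y this).1, Or.inr (hs y this).2⟩

/-! ### Bridges with ends in a set -/

/-- The bridges with both ends in `A`, viewed from a vertex `a` of `A`, inject into `A \ {a}` by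
taking the far end. -/
lemma exists_far_injOn {S : SimpleGraph V} {A : Finset V} {E : Finset (Sym2 V)}
    (hE : ∀ e ∈ E, e ∈ S.edgeSet ∧ S.IsBridge e ∧ ∀ v ∈ e, v ∈ A) {a : V}
    (hr : ∀ v ∈ A, S.Reachable a v) :
    ∃ f : Sym2 V → V, Set.InjOn f E ∧ ∀ e ∈ E, f e ∈ e ∧ ¬ (S.deleteEdges {e}).Reachable a (f e) := by
  have hex : ∀ e : Sym2 V, ∃ v, e ∈ E → v ∈ e ∧ ¬ (S.deleteEdges {e}).Reachable a v := by
    intro e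
    by_cases he : e ∈ E
    · induction e with
      | _ x y =>
      by_cases hx : (S.deleteEdges {s(x, y)}).Reachable a x
      · refine ⟨y, fun _ => ⟨by simp, fun hy => ?_⟩⟩
        exact (hE _ he).2.1 (hx.symm.trans hy)
      · exact ⟨x, fun _ => ⟨by simp, hx⟩⟩
    · exact ⟨a, fun h => absurd h he⟩
  choose f hf using hex
  refine ⟨f, ?_, fun e he => hf e he⟩
  intro e he e' he' hff
  by_contra hne
  obtain ⟨h1, h2⟩ := hf e he
  obtain ⟨h1', h2'⟩ := hf e' he'
  rw [← hff] at h1' h2'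
  generalize f e = v at h1 h2 h1' h2'
  obtain ⟨x, rfl⟩ := h1
  obtain ⟨x', rfl⟩ := h1'
  have hadj : S.Adj v x := (hE _ he).1
  have hvA := (hE _ he).2.2 v (by simp)
  have hax : (S.deleteEdges {s(v, x)}).Reachable a x :=
    ((hr v hvA).deleteEdges_or x).resolve_left h2
  obtain ⟨p⟩ := hax
  -- A walk from `a` through `vx'` would reach `v` off `vx`, but `v` is the far end.
  have hp : s(v, x') ∉ p.edges := fun hmem => h2 (by
    classical
    exact ⟨p.takeUntil v (p.fst_mem_support_of_mem_edges hmem)⟩)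
  have hax' : (S.deleteEdges {s(v, x')}).Reachable a x :=
    ((p.toDeleteEdge _ hp).reachable).mono
      (deleteEdges_mono (deleteEdges_le _))
  refine h2' (hax'.trans (Adj.reachable ?_))
  rw [deleteEdges_adj]
  refine ⟨hadj.symm, fun hc => hne ?_⟩
  rw [Set.mem_singleton_iff, Sym2.eq_swap] at hc
  exact hc

/-- Bridges form a forest: the far-end map is injective and never takes the value `a`. -/
lemma card_bridges_lt {S : SimpleGraph V} {A : Finset V} {E : Finset (Sym2 V)}
    (hE : ∀ e ∈ E, e ∈ S.edgeSet ∧ S.IsBridge e ∧ ∀ v ∈ e, v ∈ A)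
    (hA : A.Nonempty) (hr : ∀ u ∈ A, ∀ v ∈ A, S.Reachable u v) : E.card + 1 ≤ A.card := by
  classical
  obtain ⟨a, ha⟩ := hA
  obtain ⟨f, hinj, hf⟩ := exists_far_injOn hE (hr a ha)
  have hsub : E.image f ⊆ A.erase a := by
    intro v hv
    obtain ⟨e, he, rfl⟩ := Finset.mem_image.1 hv
    refine Finset.mem_erase.2 ⟨fun h => (hf e he).2 (h ▸ .rfl), (hE e he).2.2 _ (hf e he).1⟩
  have := Finset.card_le_card hsub
  rw [Finset.card_image_of_injOn hinj, Finset.card_erase_of_mem ha] at this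
  have : 0 < A.card := Finset.card_pos.2 ⟨a, ha⟩
  omega

/-- In the extremal case the far-end map is onto `A \ {a}`, so it attains `b`. -/
lemma exists_far_of_card_eq {S : SimpleGraph V} {A : Finset V} {E : Finset (Sym2 V)}
    (hE : ∀ e ∈ E, e ∈ S.edgeSet ∧ S.IsBridge e ∧ ∀ v ∈ e, v ∈ A)
    (hr : ∀ u ∈ A, ∀ v ∈ A, S.Reachable u v) (hcard : A.card ≤ E.card + 1)
    {a b : V} (ha : a ∈ A) (hb : b ∈ A) (hab : a ≠ b) :
    ∃ e ∈ E, b ∈ e ∧ ¬ (S.deleteEdges {e}).Reachable a b := by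
  classical
  obtain ⟨f, hinj, hf⟩ := exists_far_injOn hE (hr a ha)
  have hsub : E.image f ⊆ A.erase a := by
    intro v hv
    obtain ⟨e, he, rfl⟩ := Finset.mem_image.1 hv
    refine Finset.mem_erase.2 ⟨fun h => (hf e he).2 (h ▸ .rfl), (hE e he).2.2 _ (hf e he).1⟩
  have heq := Finset.eq_of_subset_of_card_le hsub (by
    rw [Finset.card_image_of_injOn hinj, Finset.card_erase_of_mem ha]; omega)
  have hb' : b ∈ E.image f := by rw [heq]; exact Finset.mem_erase.2 ⟨hab.symm, hb⟩
  obtain ⟨e, he, rfl⟩ := Finset.mem_image.1 hb'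
  exact ⟨e, he, hf e he⟩

/-- If the bridges in `E` form a spanning tree of `A`, any two nonadjacent vertices of `A` are
separated by two of them. -/
lemma exists_two_separating {S : SimpleGraph V} {A : Finset V} {E : Finset (Sym2 V)}
    (hE : ∀ e ∈ E, e ∈ S.edgeSet ∧ S.IsBridge e ∧ ∀ v ∈ e, v ∈ A)
    (hr : ∀ u ∈ A, ∀ v ∈ A, S.Reachable u v) (hcard : A.card ≤ E.card + 1)
    {a b : V} (ha : a ∈ A) (hb : b ∈ A) (hab : a ≠ b) (hnadj : ¬ S.Adj a b) :
    ∃ e ∈ E, ∃ e' ∈ E, e ≠ e' ∧ ¬ (S.deleteEdges {e}).Reachable a b ∧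
      ¬ (S.deleteEdges {e'}).Reachable a b := by
  obtain ⟨e, he, hbe, hs⟩ := exists_far_of_card_eq hE hr hcard ha hb hab
  obtain ⟨e', he', hae, hs'⟩ := exists_far_of_card_eq hE hr hcard hb ha hab.symm
  refine ⟨e, he, e', he', ?_, hs, fun h => hs' h.symm⟩
  -- One bridge serving both purposes would contain `a` and `b`, hence join them.
  rintro rfl
  have : e = s(a, b) := (Sym2.mem_and_mem_iff hab).1 ⟨hae, hbe⟩
  subst this
  exact hnadj (hE _ he).1

/-! ### Counting edges -/

/-- Each vertex other than `a` selects an edge to a neighbor nearer to `a`; the distances reveal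
which end made the selection. -/
lemma card_le_numEdges_add_one [Finite V] {R : SimpleGraph V} {A : Finset V}
    (hr : ∀ u ∈ A, ∀ v ∈ A, R.Reachable u v) : A.card ≤ numEdges R + 1 := by
  classical
  rcases A.eq_empty_or_nonempty with rfl | ⟨a, ha⟩
  · simp
  have hex : ∀ v : V, ∃ w, v ∈ A → v ≠ a → R.Adj w v ∧ R.dist a v = R.dist a w + 1 := by
    intro v
    by_cases hv : v ∈ A ∧ v ≠ a
    · obtain ⟨p, hp⟩ := (hr v hv.1 a ha).exists_walk_length_eq_dist
      cases p with
      | nil => exact absurd rfl hv.2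
      | @cons _ w _ h p =>
        refine ⟨w, fun _ _ => ⟨h.symm, ?_⟩⟩
        have h1 : R.dist a v ≤ R.dist a w + 1 := by
          have := ((hr a ha v hv.1).trans h.reachable).exists_walk_length_eq_dist
          obtain ⟨q, hq⟩ := this
          have := dist_le (q.concat h.symm)
          simp only [Walk.length_concat] at this
          omega
        have h2 : R.dist w a ≤ p.length := dist_le p
        rw [dist_comm] at h2
        simp only [Walk.length_cons] at hp
        rw [dist_comm] at hp
        omega
    · exact ⟨v, fun h h' => absurd ⟨h, h'⟩ hv⟩
  choose f hf using hex
  have : (A.erase a).card ≤ R.edgeSet.ncard := by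
    rw [← Set.ncard_coe_finset]
    refine Set.ncard_le_ncard_of_injOn (fun v => s(f v, v)) ?_ ?_ (Set.toFinite _)
    · intro v hv
      obtain ⟨h1, h2⟩ := Finset.mem_erase.1 hv
      exact (hf v h2 h1).1
    · intro v hv v' hv' h
      obtain ⟨h1, h2⟩ := Finset.mem_erase.1 hv
      obtain ⟨h1', h2'⟩ := Finset.mem_erase.1 hv'
      rcases Sym2.eq_iff.1 h with ⟨-, h⟩ | ⟨h, h'⟩
      · exact h
      · have := (hf v h2 h1).2
        have := (hf v' h2' h1').2
        rw [← h'] at this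
        rw [h] at *
        omega
  rw [Finset.card_erase_of_mem ha] at this
  unfold numEdges
  omega

lemma numEdges_sup_le [Finite V] (H K : SimpleGraph V) :
    numEdges (H ⊔ K) ≤ numEdges H + numEdges K := by
  unfold numEdges
  rw [edgeSet_sup]
  exact Set.ncard_union_le _ _

lemma numEdges_mono [Finite V] {H K : SimpleGraph V} (h : H ≤ K) : numEdges H ≤ numEdges K :=
  Set.ncard_le_ncard (edgeSet_mono h) (Set.toFinite _)

lemma numEdges_fromEdgeSet_le [Finite V] (s : Finset (Sym2 V)) :
    numEdges (fromEdgeSet (s : Set (Sym2 V))) ≤ s.card := by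
  unfold numEdges
  rw [edgeSet_fromEdgeSet, ← Set.ncard_coe_finset]
  exact Set.ncard_le_ncard Set.sdiff_subset (Set.toFinite _)

/-- A walk that ends in a set has an initial path that meets the set in its last vertex only. -/
lemma Walk.exists_isPath_first {S : SimpleGraph V} {z t : V} (p : S.Walk z t) {T : Set V}
    (ht : t ∈ T) :
    ∃ x ∈ T, ∃ q : S.Walk z x, q.IsPath ∧ ∀ y ∈ q.support, y ∈ p.support ∧ (y ∈ T → y = x) := by
  classical
  induction p with
  | @nil u => exact ⟨u, ht, Walk.nil, by simp, by simp⟩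
  | @cons u v w h p ih =>
    by_cases hu : u ∈ T
    · exact ⟨u, hu, Walk.nil, by simp, by simp⟩
    · obtain ⟨x, hx, q, -, hs⟩ := ih ht
      refine ⟨x, hx, (q.cons h).bypass, bypass_isPath _, fun y hy => ?_⟩
      have := support_bypass_subset_support _ hy
      simp only [support_cons, List.mem_cons] at this ⊢
      rcases this with rfl | this
      · exact ⟨Or.inl rfl, fun h => absurd h hu⟩
      · exact ⟨Or.inr (hs y this).1, (hs y this).2⟩

/-! ### Partial subgraphs and ears -/

/-- `H` is a subgraph of `G` on the vertex set `T`, connected there, that contains `S` and whose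
bridges are edges of `S`. -/
structure IsPartial (G S H : SimpleGraph V) (T : Finset V) : Prop where
  le : H ≤ G
  base_le : S ≤ H
  mem : ∀ ⦃u v⦄, H.Adj u v → u ∈ T
  reach : ∀ u ∈ T, ∀ v ∈ T, H.Reachable u v
  bridge : ∀ e ∈ H.edgeSet, H.IsBridge e → e ∈ S.edgeSet

lemma IsPartial.mem_of_mem_edge {G S H : SimpleGraph V} {T : Finset V} (h : IsPartial G S H T)
    {e : Sym2 V} (he : e ∈ H.edgeSet) {v : V} (hv : v ∈ e) : v ∈ T := by
  obtain ⟨w, rfl⟩ := hv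
  exact h.mem (show H.Adj v w from he)

/-- Adding an ear. -/
lemma IsPartial.exists_add_ear [Finite V] [DecidableEq V] {G S H : SimpleGraph V} {T : Finset V}
    (h : IsPartial G S H T) {c d z z' : V} (hc : c ∈ T) (hd : d ∈ T) (q : G.Walk z z')
    (hq : q.IsPath) (hqT : ∀ y ∈ q.support, y ∉ T) (hcz : G.Adj c z) (hdz : G.Adj d z')
    (hne : c = d → z ≠ z') :
    ∃ H', H ≤ H' ∧ IsPartial G S H' (T ∪ q.support.toFinset) ∧
      numEdges H' ≤ numEdges H + (q.support.toFinset.card + 1) ∧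
      ∀ e ∈ H.edgeSet, (H'.deleteEdges {e}).Reachable c d := by
  set p : G.Walk c d := Walk.cons hcz (q.concat hdz.symm) with hp
  have hpe : p.edges = s(c, z) :: (q.edges ++ [s(z', d)]) := by
    simp [hp, Walk.edges_concat]
  have hps : p.support = c :: (q.support ++ [d]) := by
    simp [hp, Walk.support_concat]
  have hout : ∀ e ∈ p.edges, ∃ v ∈ e, v ∉ T := by
    intro e he
    rw [hpe] at he
    simp only [List.mem_cons, List.mem_append, List.not_mem_nil, or_false] at he
    rcases he with rfl | he | rfl
    · exact ⟨z, by simp, hqT _ q.start_mem_support⟩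
    · induction e with
      | _ x y => exact ⟨x, by simp, hqT _ (q.fst_mem_support_of_mem_edges he)⟩
    · exact ⟨z', by simp, hqT _ q.end_mem_support⟩
  have hpH : ∀ e ∈ p.edges, e ∉ H.edgeSet := by
    intro e he heH
    obtain ⟨v, hv, hvT⟩ := hout e he
    exact hvT (h.mem_of_mem_edge heH hv)
  have hcq : ∀ t, s(c, t) ∉ q.edges := fun t ht => hqT _ (q.fst_mem_support_of_mem_edges ht) hc
  have hdq : ∀ t, s(t, d) ∉ q.edges := fun t ht => hqT _ (q.snd_mem_support_of_mem_edges ht) hd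
  -- A closed ear with `z = z'` would run back along its first edge; `hne` excludes exactly this.
  have htrail : p.IsTrail := by
    rw [Walk.isTrail_def, hpe, List.nodup_cons, List.nodup_append]
    refine ⟨?_, hq.isTrail.edges_nodup, by simp, ?_⟩
    · simp only [List.mem_append, List.mem_singleton, not_or]
      refine ⟨hcq _, fun hc' => ?_⟩
      rcases Sym2.eq_iff.1 hc' with ⟨rfl, rfl⟩ | ⟨h1, h2⟩
      · exact hqT _ q.end_mem_support hc
      · exact hne h1 h2
    · intro e he e' he' hee
      rw [List.mem_singleton] at he'
      subst hee he'
      exact hdq _ he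
  set H' : SimpleGraph V := H ⊔ fromEdgeSet (p.edges.toFinset : Set (Sym2 V)) with hH'
  have hpH' : ∀ e ∈ p.edges, e ∈ H'.edgeSet := by
    intro e he
    rw [hH', edgeSet_sup, edgeSet_fromEdgeSet]
    refine Or.inr ⟨by simpa using he, ?_⟩
    exact G.not_isDiag_of_mem_edgeSet (p.edges_subset_edgeSet he)
  have hmemH' : ∀ e ∈ H'.edgeSet, e ∈ H.edgeSet ∨ e ∈ p.edges := by
    intro e he
    rw [hH', edgeSet_sup, edgeSet_fromEdgeSet] at he
    exact he.imp id fun h => by simpa using h.1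
  set p' : H'.Walk c d := p.transfer H' hpH' with hp'
  have hp'e : p'.edges = p.edges := Walk.edges_transfer _ _
  have hp's : p'.support = p.support := Walk.support_transfer _ _
  have hp't : p'.IsTrail := by
    rw [Walk.isTrail_def, hp'e]; exact htrail.edges_nodup
  have hle : H ≤ H' := le_sup_left
  refine ⟨H', hle, ⟨?_, h.base_le.trans hle, ?_, ?_, ?_⟩, ?_, ?_⟩
  · refine sup_le h.le ?_
    rw [fromEdgeSet_le]
    intro e he
    exact p.edges_subset_edgeSet (by simpa using he.1)
  · intro u v huv
    rcases hmemH' s(u, v) huv with hh | hh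
    · exact Finset.mem_union_left _ (h.mem hh)
    · have := p.fst_mem_support_of_mem_edges hh
      rw [hps] at this
      simp only [List.mem_cons, List.mem_append, List.not_mem_nil, or_false] at this
      rw [Finset.mem_union, List.mem_toFinset]
      rcases this with rfl | this | rfl
      · exact Or.inl hc
      · exact Or.inr this
      · exact Or.inl hd
  · have key : ∀ u ∈ T ∪ q.support.toFinset, H'.Reachable c u := by
      intro u hu
      rw [Finset.mem_union, List.mem_toFinset] at hu
      rcases hu with hu | hu
      · exact (h.reach c hc u hu).mono hle
      · exact ⟨p'.takeUntil u (by rw [hp's, hps]; simp [hu])⟩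
    exact fun u hu v hv => (key u hu).symm.trans (key v hv)
  · intro e he hb
    by_cases heH : e ∈ H.edgeSet
    · exact h.bridge e heH (hb.anti hle)
    · exfalso
      have hep := (hmemH' e he).resolve_left heH
      have hle' : H ≤ H'.deleteEdges {e} := by
        intro u v huv
        rw [deleteEdges_adj]
        refine ⟨hle huv, ?_⟩
        rintro rfl
        exact heH huv
      have hcd := (h.reach c hc d hd).mono hle'
      induction e with
      | _ x y =>
      -- Off an edge of the ear, the two remaining pieces still lead to `c` and `d`, which `H`
      -- joins.
      rcases hp't.reachable_deleteEdges (by rw [hp'e]; exact hep) with ⟨h1, h2⟩ | ⟨h1, h2⟩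
      · exact hb (h1.symm.trans (hcd.trans h2.symm))
      · exact hb (h2.trans (hcd.symm.trans h1))
  · refine (numEdges_sup_le _ _).trans (Nat.add_le_add_left ((numEdges_fromEdgeSet_le _).trans ?_) _)
    refine (List.toFinset_card_le _).trans ?_
    rw [List.toFinset_card_of_nodup hq.support_nodup, hpe]
    simp
  · intro e he
    refine (p'.toDeleteEdge e ?_).reachable
    rw [hp'e]
    exact fun hep => hpH e hep he

/-- Two distinct edges of a connected graph, separating `a, b` and `a', b'` respectively: some pair
of ends is separated by both. -/
lemma exists_separated_by_both {S : SimpleGraph V} {e e' : Sym2 V} (he' : e' ∈ S.edgeSet)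
    (hne : e ≠ e') {a b a' b' : V} (hab : S.Reachable a b) (haa : S.Reachable a a')
    (hab' : S.Reachable a b') (hx : ∀ x ∈ e', S.Reachable a x)
    (h : ¬ (S.deleteEdges {e}).Reachable a b) (h' : ¬ (S.deleteEdges {e'}).Reachable a' b') :
    ∃ c d, (c = a ∨ c = b) ∧ (d = a' ∨ d = b') ∧ ¬ (S.deleteEdges {e}).Reachable c d ∧
      ¬ (S.deleteEdges {e'}).Reachable c d := by
  induction e' with
  | _ x y =>
  have hax := hx x (by simp)
  -- The side of `e` away from `e'` stays connected when `e'` is deleted. So an end `c` on that side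
  -- and an end `d` beyond `e'` from it form the desired pair.
  have key : ∀ u v, S.Reachable a u → S.Reachable a v → ¬ (S.deleteEdges {e}).Reachable u x →
      ¬ (S.deleteEdges {e}).Reachable v x → (S.deleteEdges {s(x, y)}).Reachable u v := by
    intro u v hu hv hux hvx
    have huv : (S.deleteEdges {e}).Reachable u v := by
      rcases (hu.symm.trans hv).deleteEdges_three (hu.symm.trans hax) e with h | h | h
      · exact h
      · exact absurd h hux
      · exact absurd h hvx
    obtain ⟨p⟩ := huv
    have hp : s(x, y) ∉ p.edges := fun hmem => hux (by
      classical
      exact ⟨p.takeUntil x (p.fst_mem_support_of_mem_edges hmem)⟩)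
    exact (p.toDeleteEdge _ hp).reachable.mono (deleteEdges_mono (deleteEdges_le _))
  by_contra! hcon
  have h1 : ∀ c d, (c = a ∨ c = b) → (d = a' ∨ d = b') → (S.deleteEdges {e}).Reachable c d ∨
      (S.deleteEdges {s(x, y)}).Reachable c d := fun c d hc hd => by
    by_contra! hh
    exact hh.2 (hcon c d hc hd hh.1)
  have e1 := h1 a a' (Or.inl rfl) (Or.inl rfl)
  have e2 := h1 a b' (Or.inl rfl) (Or.inr rfl)
  have e3 := h1 b a' (Or.inr rfl) (Or.inl rfl)
  have e4 := h1 b b' (Or.inr rfl) (Or.inr rfl)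
  have ka := key a a' .rfl haa
  have ka' := key a b' .rfl hab'
  have kb := key b a' hab haa
  have kb' := key b b' hab hab'
  have tr : ∀ {u v w : V}, (S.deleteEdges {e}).Reachable u v → (S.deleteEdges {e}).Reachable v w →
    (S.deleteEdges {e}).Reachable u w := fun h h' => h.trans h'
  have sy : ∀ {u v : V}, (S.deleteEdges {e}).Reachable u v → (S.deleteEdges {e}).Reachable v u :=
    fun h => h.symm
  have tr' : ∀ {u v w : V}, (S.deleteEdges {s(x, y)}).Reachable u v →
    (S.deleteEdges {s(x, y)}).Reachable v w → (S.deleteEdges {s(x, y)}).Reachable u w :=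
    fun h h' => h.trans h'
  have sy' : ∀ {u v : V}, (S.deleteEdges {s(x, y)}).Reachable u v →
    (S.deleteEdges {s(x, y)}).Reachable v u := fun h => h.symm
  -- What remains is a combinatorial argument about two symmetric transitive relations and the four
  -- instances of `key`.
  generalize (S.deleteEdges {e}).Reachable = R at *
  generalize (S.deleteEdges {s(x, y)}).Reachable = R' at *
  clear hcon h1 key
  rcases e1 with e1 | e1
  · have f3 : R' b a' := e3.resolve_left fun hh => h (tr e1 (sy hh))
    have f4 : R b b' := e4.resolve_right fun hh => h' (tr' (sy' f3) hh)
    have f2 : R' a b' := e2.resolve_left fun hh => h (tr hh (sy f4))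
    have f1 : ¬ R' a a' := fun hh => h' (tr' (sy' hh) f2)
    by_cases hax' : R a x
    · have hb : ¬ R b x := fun hh => h (tr hax' (sy hh))
      have := kb' hb fun hh => hb (tr f4 hh)
      exact h' (tr' (sy' f3) this)
    · exact f1 (ka hax' fun hh => hax' (tr e1 hh))
  · have f2 : R a b' := e2.resolve_right fun hh => h' (tr' (sy' e1) hh)
    have f4 : R' b b' := e4.resolve_left fun hh => h (tr f2 (sy hh))
    have f3 : R b a' := e3.resolve_right fun hh => h' (tr' (sy' hh) f4)
    by_cases hax' : R a x
    · have hb : ¬ R b x := fun hh => h (tr hax' (sy hh))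
      have := kb hb fun hh => hb (tr f3 hh)
      exact h' (tr' (sy' this) f4)
    · have := ka' hax' fun hh => hax' (tr f2 hh)
      exact h' (tr' (sy' e1) this)

/-- If `e` separates both `a, b` and `c, d` in `S`, joining `c, d` off `e` joins `a, b` off `e`. -/
lemma Reachable.of_separated {S H : SimpleGraph V} (hle : S ≤ H) {e : Sym2 V} {a b c d : V}
    (hca : S.Reachable c a) (hcb : S.Reachable c b) (hcd : S.Reachable c d)
    (hs : ¬ (S.deleteEdges {e}).Reachable c d) (hr : (H.deleteEdges {e}).Reachable c d) :
    (H.deleteEdges {e}).Reachable a b := by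
  have hmono : S.deleteEdges {e} ≤ H.deleteEdges {e} := deleteEdges_mono hle
  have key : ∀ u, S.Reachable c u → (H.deleteEdges {e}).Reachable c u := by
    intro u hu
    rcases hcd.deleteEdges_three hu e with h | h | h
    · exact absurd h hs
    · exact h.mono hmono
    · exact hr.trans (h.mono hmono)
  exact (key a hca).symm.trans (key b hcb)

/-- An ear attached to the vertex set `U` of `S`: its inner vertices form a path outside `U`, and
its ends `a`, `b` are separated in `S` by the edge `e`. -/
structure Ear (G S : SimpleGraph V) (U : Finset V) where
  a : V
  b : V
  z : V
  z' : V
  q : G.Walk z z'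
  e : Sym2 V
  a_mem : a ∈ U
  b_mem : b ∈ U
  adj_a : G.Adj a z
  adj_b : G.Adj b z'
  isPath : q.IsPath
  notMem : ∀ y ∈ q.support, y ∉ U
  e_mem : e ∈ S.edgeSet
  sep : ¬ (S.deleteEdges {e}).Reachable a b

namespace Ear

variable {G S : SimpleGraph V} {U : Finset V}

/-- The inner vertices of an ear. -/
def inner [DecidableEq V] (E : Ear G S U) : Finset V := E.q.support.toFinset

/-- The ends of the ear are not yet joined off the edge `e` in `H`. -/
def Open (E : Ear G S U) (H : SimpleGraph V) : Prop := ¬ (H.deleteEdges {E.e}).Reachable E.a E.b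

lemma Open.anti {E : Ear G S U} {H H' : SimpleGraph V} (h : E.Open H') (hle : H ≤ H') :
    E.Open H := fun hr => h (hr.mono (deleteEdges_mono hle))

/-- Makes the two ends of an ear interchangeable, as the crossing argument cannot choose which end
it receives. -/
lemma exists_walk [DecidableEq V] (E : Ear G S U) {c : V} (hc : c = E.a ∨ c = E.b) :
    c ∈ U ∧ ∃ x ∈ E.inner, G.Adj c x ∧ ∀ y ∈ E.inner, ∃ p : G.Walk x y, ∀ t ∈ p.support, t ∈ E.inner := by
  rcases hc with rfl | rfl
  · refine ⟨E.a_mem, E.z, List.mem_toFinset.2 E.q.start_mem_support, E.adj_a, fun y hy => ?_⟩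
    refine ⟨E.q.takeUntil y (List.mem_toFinset.1 hy), fun t ht => List.mem_toFinset.2 ?_⟩
    exact E.q.support_takeUntil_subset_support _ ht
  · refine ⟨E.b_mem, E.z', List.mem_toFinset.2 E.q.end_mem_support, E.adj_b, fun y hy => ?_⟩
    refine ⟨(E.q.dropUntil y (List.mem_toFinset.1 hy)).reverse, fun t ht => List.mem_toFinset.2 ?_⟩
    rw [Walk.support_reverse, List.mem_reverse] at ht
    exact E.q.support_dropUntil_subset_support _ ht

lemma mem_of_mem_inner [DecidableEq V] (E : Ear G S U) {y : V} (hy : y ∈ E.inner) : y ∉ U :=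
  E.notMem y (List.mem_toFinset.1 hy)

end Ear

/-! ### Growing a spanning subgraph within the budget -/

section Growth

open Classical in
/-- The budget inequality kept while ears are added. -/
def EarBudget {κ : Type*} {G S : SimpleGraph V} {U : Finset V} (K : Finset κ)
    (E : κ → Ear G S U) (H : SimpleGraph V) (T : Finset V) : Prop :=
  numEdges H + (K.filter fun k => (E k).Open H ∧ ∃ y ∈ (E k).inner, y ∈ T).card ≤
    numEdges S + ∑ z ∈ T \ U, max 2 (K.filter fun k => z ∈ (E k).inner).card

-- `F` bounds the open ears touched for the first time by `W`. Each of them must be given one unit,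
-- on top of the `|W| + 1` new edges.
open Classical in
lemma EarBudget.add {κ : Type*} [Finite V] {G S : SimpleGraph V} {U : Finset V} {K : Finset κ}
    {E : κ → Ear G S U} {H H' : SimpleGraph V} {T W : Finset V} (hb : EarBudget K E H T)
    (hUT : U ⊆ T) (hW : Disjoint T W) (hle : H ≤ H') (hnum : numEdges H' ≤ numEdges H + (W.card + 1))
    {F : Finset κ} (hF : ∀ k ∈ K, (E k).Open H' → (∀ y ∈ (E k).inner, y ∉ T) →
      (∃ y ∈ (E k).inner, y ∈ W) → k ∈ F)
    (hn : W.card + 1 + F.card ≤ ∑ z ∈ W, max 2 (K.filter fun k => z ∈ (E k).inner).card) :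
    EarBudget K E H' (T ∪ W) := by
  unfold EarBudget at hb ⊢
  have hsum : ∑ z ∈ (T ∪ W) \ U, max 2 (K.filter fun k => z ∈ (E k).inner).card =
      ∑ z ∈ T \ U, max 2 (K.filter fun k => z ∈ (E k).inner).card +
      ∑ z ∈ W, max 2 (K.filter fun k => z ∈ (E k).inner).card := by
    rw [Finset.union_sdiff_distrib, Finset.sum_union]
    · congr 2
      exact Finset.sdiff_eq_self_of_disjoint (hW.mono_left hUT).symm
    · exact hW.mono Finset.sdiff_subset Finset.sdiff_subset
  have hcard : (K.filter fun k => (E k).Open H' ∧ ∃ y ∈ (E k).inner, y ∈ T ∪ W).card ≤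
      (K.filter fun k => (E k).Open H ∧ ∃ y ∈ (E k).inner, y ∈ T).card + F.card := by
    refine (Finset.card_le_card ?_).trans (Finset.card_union_le _ _)
    intro k hk
    obtain ⟨hkK, ho, y, hy, hyT⟩ := Finset.mem_filter.1 hk
    rw [Finset.mem_union, Finset.mem_filter]
    by_cases ht : ∃ y ∈ (E k).inner, y ∈ T
    · exact Or.inl ⟨hkK, ho.anti hle, ht⟩
    · push Not at ht
      refine Or.inr (hF k hkK ho ht ⟨y, hy, ?_⟩)
      exact (Finset.mem_union.1 hyT).resolve_left (ht y hy)
  omega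

open Classical in
/-- Enlarging a partial subgraph within the budget. -/
lemma EarBudget.exists_larger {κ : Type*} [Fintype V] {G S : SimpleGraph V} {U : Finset V}
    (hG : G.IsEdgeConnected 2) (hU : U.Nonempty) (hSU : ∀ u ∈ U, ∀ v ∈ U, S.Reachable u v)
    (hSmem : ∀ e ∈ S.edgeSet, ∀ v ∈ e, v ∈ U)
    {K : Finset κ} {E : κ → Ear G S U}
    (hinj : ∀ k ∈ K, ∀ k' ∈ K, (E k).e = (E k').e → k = k')
    {H : SimpleGraph V} {T : Finset V} (hUT : U ⊆ T) (hH : IsPartial G S H T)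
    (hb : EarBudget K E H T) (hT : T ≠ Finset.univ) :
    ∃ H' T', T ⊂ T' ∧ IsPartial G S H' T' ∧ EarBudget K E H' T' := by
  -- Two units per vertex pay for an ear, since `|W| + 1 ≤ 2|W|`.
  have hpos : ∀ W : Finset V, W.Nonempty → W.card + 1 ≤
      ∑ z ∈ W, max 2 (K.filter fun k => z ∈ (E k).inner).card := by
    intro W hW
    have h1 : 2 * W.card ≤ ∑ z ∈ W, max 2 (K.filter fun k => z ∈ (E k).inner).card := by
      rw [mul_comm, ← smul_eq_mul]
      exact Finset.card_nsmul_le_sum _ _ _ fun z _ => le_max_left _ _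
    have := hW.card_pos
    omega
  have hss : ∀ W : Finset V, W.Nonempty → Disjoint T W → T ⊂ T ∪ W := by
    intro W ⟨w, hw⟩ hd
    refine Finset.ssubset_iff_subset_ne.2 ⟨Finset.subset_union_left, fun h => ?_⟩
    exact Finset.disjoint_left.1 hd (h ▸ Finset.mem_union_right T hw) hw
  have hcover : ∀ k : κ, ∀ c ∈ U, ∀ d ∈ U, ∀ H' : SimpleGraph V, S ≤ H' →
      ¬ (S.deleteEdges {(E k).e}).Reachable c d → (H'.deleteEdges {(E k).e}).Reachable c d →
      ¬ (E k).Open H' := by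
    intro k c hc d hd H' hle hs hr ho
    exact ho (Reachable.of_separated hle (hSU _ hc _ (E k).a_mem) (hSU _ hc _ (E k).b_mem)
      (hSU _ hc _ hd) hs hr)
  -- Case of two crossing ears that both still avoid `T`: a single path from an end of one to an end
  -- of the other settles both.
  by_cases hA : ∃ k ∈ K, ∃ k' ∈ K, k ≠ k' ∧ (∀ y ∈ (E k).inner, y ∉ T) ∧
      (∀ y ∈ (E k').inner, y ∉ T) ∧ ∃ y ∈ (E k).inner, y ∈ (E k').inner
  · obtain ⟨k, hk, k', hk', hne, hkT, hkT', y, hy, hy'⟩ := hA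
    obtain ⟨c, d, hc, hd, hs, hs'⟩ := exists_separated_by_both (E k').e_mem
      (fun h => hne (hinj k hk k' hk' h)) (hSU _ (E k).a_mem _ (E k).b_mem)
      (hSU _ (E k).a_mem _ (E k').a_mem) (hSU _ (E k).a_mem _ (E k').b_mem)
      (fun x hx => hSU _ (E k).a_mem _ (hSmem _ (E k').e_mem x hx)) (E k).sep (E k').sep
    obtain ⟨hcU, zc, hzc, hczc, hpc⟩ := (E k).exists_walk hc
    obtain ⟨hdU, zd, hzd, hdzd, hpd⟩ := (E k').exists_walk hd
    obtain ⟨p, hp⟩ := hpc y hy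
    -- Cutting at the first vertex on the other ear makes the two pieces meet in `x` only.
    obtain ⟨x, hx, p1, hp1, hp1s⟩ := p.exists_isPath_first (T := (E k').inner) hy'
    obtain ⟨p2, hp2⟩ := hpd x hx
    set r : G.Walk zc zd := p1.append p2.reverse.bypass with hr
    have hp2s : ∀ t ∈ p2.reverse.bypass.support, t ∈ (E k').inner := by
      intro t ht
      have := Walk.support_bypass_subset_support _ ht
      rw [Walk.support_reverse, List.mem_reverse] at this
      exact hp2 t this
    have hrs : ∀ t ∈ r.support, t ∈ (E k).inner ∨ t ∈ (E k').inner := by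
      intro t ht
      rw [hr, Walk.mem_support_append_iff] at ht
      exact ht.imp (fun h => hp t (hp1s t h).1) (hp2s t)
    have hrp : r.IsPath := by
      have hp2p : p2.reverse.bypass.IsPath := Walk.bypass_isPath _
      refine Walk.IsPath.mk' ?_
      rw [hr, Walk.support_append, List.nodup_append]
      refine ⟨hp1.support_nodup, hp2p.support_nodup.tail, ?_⟩
      intro t ht t' ht' htt
      subst htt
      have h1 : t = x := (hp1s t ht).2 (hp2s t (List.mem_of_mem_tail ht'))
      subst h1
      have := hp2p.support_nodup
      rw [← Walk.cons_tail_support, List.nodup_cons] at this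
      exact this.1 ht'
    have hrT : ∀ t ∈ r.support, t ∉ T := fun t ht => (hrs t ht).elim (hkT t) (hkT' t)
    have hcd : c ≠ d := by
      rintro rfl
      exact hs .rfl
    obtain ⟨H', hle, hH', hnum, hcov⟩ := hH.exists_add_ear (hUT hcU) (hUT hdU) r hrp hrT hczc hdzd
      (fun h => absurd h hcd)
    have hdisj : Disjoint T r.support.toFinset :=
      Finset.disjoint_right.2 fun t ht => hrT t (List.mem_toFinset.1 ht)
    have hxr : x ∈ r.support.toFinset := List.mem_toFinset.2 (by
      rw [hr, Walk.mem_support_append_iff]; exact Or.inl p1.end_mem_support)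
    have hck : ¬ (E k).Open H' := hcover k c hcU d hdU H' hH'.base_le hs
      (hcov _ (edgeSet_mono hH.base_le (E k).e_mem))
    have hck' : ¬ (E k').Open H' := hcover k' c hcU d hdU H' hH'.base_le hs'
      (hcov _ (edgeSet_mono hH.base_le (E k').e_mem))
    set W := r.support.toFinset with hWdef
    -- All ears through the new vertices may become touched, except `k` and `k'`, which are no
    -- longer open.
    refine ⟨H', _, hss _ ⟨x, hxr⟩ hdisj, hH', hb.add hUT hdisj hle hnum
      (F := W.biUnion fun w => ((K.erase k).erase k').filter fun i => w ∈ (E i).inner) ?_ ?_⟩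
    · rintro i hiK ho - ⟨t, ht, htW⟩
      refine Finset.mem_biUnion.2 ⟨t, htW, Finset.mem_filter.2 ⟨?_, ht⟩⟩
      rw [Finset.mem_erase, Finset.mem_erase]
      refine ⟨?_, ?_, hiK⟩
      · rintro rfl; exact hck' ho
      · rintro rfl; exact hck ho
    -- Every new vertex lies on `k` or `k'`, and `x` on both. The units of these two ears yield `|W|
    -- + 1`, the price of the path; the others go to `F`.
    have hterm : ∀ w ∈ W, (((K.erase k).erase k').filter fun i => w ∈ (E i).inner).card +
        (1 + if w = x then 1 else 0) ≤ max 2 (K.filter fun i => w ∈ (E i).inner).card := by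
      intro w hw
      refine le_trans ?_ (le_max_right _ _)
      have hw' := hrs w (List.mem_toFinset.1 hw)
      have hfil : ((K.erase k).erase k').filter (fun i => w ∈ (E i).inner) =
          ((K.filter fun i => w ∈ (E i).inner).erase k).erase k' := by
        rw [Finset.filter_erase, Finset.filter_erase]
      rw [hfil]
      by_cases hwx : w = x
      · subst hwx
        have m1 : k ∈ K.filter fun i => w ∈ (E i).inner :=
          Finset.mem_filter.2 ⟨hk, hp _ (hp1s _ p1.end_mem_support).1⟩
        have m2 : k' ∈ (K.filter fun i => w ∈ (E i).inner).erase k :=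
          Finset.mem_erase.2 ⟨hne.symm, Finset.mem_filter.2 ⟨hk', hx⟩⟩
        have c1 := Finset.card_erase_add_one m1
        have c2 := Finset.card_erase_add_one m2
        simp only [if_true]
        omega
      · simp only [hwx, if_false]
        rcases hw' with hw' | hw'
        · have m1 : k ∈ K.filter fun i => w ∈ (E i).inner := Finset.mem_filter.2 ⟨hk, hw'⟩
          have c1 := Finset.card_erase_add_one m1
          have c2 := Finset.card_erase_le (s := (K.filter fun i => w ∈ (E i).inner).erase k) (a := k')
          omega
        · have m1 : k' ∈ K.filter fun i => w ∈ (E i).inner := Finset.mem_filter.2 ⟨hk', hw'⟩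
          have c1 := Finset.card_erase_add_one m1
          have c2 := Finset.card_erase_le (s := (K.filter fun i => w ∈ (E i).inner).erase k') (a := k)
          rw [Finset.erase_right_comm]
          omega
    refine (Nat.add_le_add_left Finset.card_biUnion_le _).trans ?_
    have hsum := Finset.sum_le_sum hterm
    rw [Finset.sum_add_distrib, Finset.sum_add_distrib, Finset.sum_ite_eq' W x, if_pos hxr,
      Finset.sum_const, smul_eq_mul, mul_one] at hsum
    omega
  push Not at hA
  -- An ear avoiding `T` meets no other such ear now, so adding it touches no further open ear for
  -- the first time.
  by_cases hB : ∃ k ∈ K, ∀ y ∈ (E k).inner, y ∉ T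
  · obtain ⟨k, hk, hkT⟩ := hB
    have hcd : (E k).a ≠ (E k).b := by
      intro h
      exact (E k).sep (h ▸ .rfl)
    obtain ⟨H', hle, hH', hnum, hcov⟩ := hH.exists_add_ear (hUT (E k).a_mem) (hUT (E k).b_mem)
      (E k).q (E k).isPath (fun y hy => hkT y (List.mem_toFinset.2 hy)) (E k).adj_a (E k).adj_b
      (fun h => absurd h hcd)
    have hdisj : Disjoint T (E k).q.support.toFinset :=
      Finset.disjoint_right.2 fun t ht => hkT t ht
    have hnon : (E k).q.support.toFinset.Nonempty :=
      ⟨(E k).z, List.mem_toFinset.2 (E k).q.start_mem_support⟩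
    refine ⟨H', _, hss _ hnon hdisj, hH', hb.add hUT hdisj hle hnum (F := ∅) ?_ (hpos _ hnon)⟩
    · rintro i hi ho hiT ⟨y, hy, hyW⟩
      exfalso
      by_cases hik : k = i
      · subst hik
        exact hcover k _ (E k).a_mem _ (E k).b_mem H' hH'.base_le (E k).sep
          (hcov _ (edgeSet_mono hH.base_le (E k).e_mem)) ho
      · exact hA k hk i hi hik hkT hiT y hyW hy
  push Not at hB
  -- All ears already touch `T`, so any ear of `G` serves.
  obtain ⟨w, hw⟩ : ∃ w, w ∉ T := by
    by_contra! h
    exact hT (Finset.eq_univ_iff_forall.2 h)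
  obtain ⟨u, hu⟩ := hU
  obtain ⟨p0⟩ := (hG.preconnected (by norm_num)) w u
  obtain ⟨v, t, ht, hadj, q0, -, hq0⟩ := p0.exists_isPath_until (T := T) hw (hUT hu)
  have hvT : v ∉ T := (hq0 v q0.end_mem_support).1
  -- Returning to `T` off the edge `tv` prevents the ear from being that edge traversed twice.
  obtain ⟨p1⟩ := isEdgeConnected_two.1 hG s(t, v) v t
  obtain ⟨v', t', ht', hadj', q, hqp, hq⟩ := p1.exists_isPath_until (T := T) hvT ht
  have hrT : ∀ y ∈ (q.mapLe (deleteEdges_le _)).support, y ∉ T := by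
    intro y hy
    rw [Walk.support_mapLe_eq_support] at hy
    exact (hq y hy).1
  obtain ⟨H', hle, hH', hnum, -⟩ := hH.exists_add_ear ht ht' (q.mapLe (deleteEdges_le _))
    (by simpa using hqp) hrT hadj.symm
    (deleteEdges_le _ hadj'.symm) (by
      rintro rfl rfl
      rw [deleteEdges_adj] at hadj'
      exact hadj'.2 (by rw [Sym2.eq_swap]; rfl))
  have hdisj : Disjoint T (q.mapLe (deleteEdges_le _)).support.toFinset :=
    Finset.disjoint_right.2 fun t ht => hrT t (List.mem_toFinset.1 ht)
  have hnon : (q.mapLe (deleteEdges_le (G := G) {s(t, v)})).support.toFinset.Nonempty :=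
    ⟨v, List.mem_toFinset.2 (Walk.start_mem_support _)⟩
  refine ⟨H', _, hss _ hnon hdisj, hH', hb.add hUT hdisj hle hnum (F := ∅) ?_ (hpos _ hnon)⟩
  intro i hi _ hiT _
  obtain ⟨y, hy, hyT⟩ := hB i hi
  exact absurd hyT (hiT y hy)

open Classical in
/-- A connected graph `S` on `U` extends to a spanning connected subgraph without further bridges,
where each new vertex `z` pays for as many edges as there are ears through it, and at least two. -/
theorem exists_spanning_of_ears {κ : Type*} [Fintype V] {G S : SimpleGraph V} {U : Finset V}
    (hG : G.IsEdgeConnected 2) (hU : U.Nonempty) (hSG : S ≤ G)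
    (hSU : ∀ u ∈ U, ∀ v ∈ U, S.Reachable u v) (hSmem : ∀ e ∈ S.edgeSet, ∀ v ∈ e, v ∈ U)
    (K : Finset κ) (E : κ → Ear G S U)
    (hinj : ∀ k ∈ K, ∀ k' ∈ K, (E k).e = (E k').e → k = k') :
    ∃ H, IsPartial G S H Finset.univ ∧
      numEdges H + (K.filter fun k => (E k).Open H).card ≤
        numEdges S + ∑ z ∈ Uᶜ, max 2 (K.filter fun k => z ∈ (E k).inner).card := by
  have main : ∀ n, ∀ (T : Finset V) (H : SimpleGraph V), Tᶜ.card ≤ n → U ⊆ T →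
      IsPartial G S H T → EarBudget K E H T →
      ∃ H, IsPartial G S H Finset.univ ∧ EarBudget K E H Finset.univ := by
    intro n
    induction n with
    | zero =>
      intro T H hn hUT hH hb
      have : T = Finset.univ := by
        rw [← Finset.compl_eq_empty_iff]
        exact Finset.card_eq_zero.1 (by omega)
      subst this
      exact ⟨H, hH, hb⟩
    | succ n ih =>
      intro T H hn hUT hH hb
      by_cases hT : T = Finset.univ
      · subst hT
        exact ⟨H, hH, hb⟩
      · obtain ⟨H', T', hTT, hH', hb'⟩ := hb.exists_larger hG hU hSU hSmem hinj hUT hH hT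
        refine ih T' H' ?_ (hUT.trans hTT.subset) hH' hb'
        have := Finset.card_lt_card (Finset.compl_ssubset_compl.2 hTT)
        omega
  -- Initially no ear is touched, since inner vertices avoid `U`.
  obtain ⟨H, hH, hb⟩ := main _ U S le_rfl subset_rfl
    ⟨hSG, le_rfl, fun u v h => hSmem s(u, v) h u (by simp), hSU, fun e he _ => he⟩ (by
      unfold EarBudget
      rw [Finset.sdiff_self, Finset.sum_empty, Finset.card_eq_zero.2]
      refine Finset.filter_eq_empty_iff.2 ?_
      rintro k - ⟨-, y, hy, hyU⟩
      exact (E k).mem_of_mem_inner hy hyU)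
  refine ⟨H, hH, ?_⟩
  unfold EarBudget at hb
  rw [← Finset.compl_eq_univ_sdiff] at hb
  -- Once `T` is everything, each open ear is touched, at its vertex `z` for instance.
  refine le_trans (Nat.add_le_add_left (Finset.card_le_card fun k hk => ?_) _) hb
  obtain ⟨hkK, ho⟩ := Finset.mem_filter.1 hk
  exact Finset.mem_filter.2 ⟨hkK, ho, (E k).z, List.mem_toFinset.2 (E k).q.start_mem_support,
    Finset.mem_univ _⟩

end Growth

/-! ### Repairing bridges -/

/-- A connected spanning subgraph becomes `2`-edge-connected after adding one edge per bridge. -/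
lemma exists_isEdgeConnected_two_of_bridges [Finite V] {G : SimpleGraph V}
    (hG : G.IsEdgeConnected 2) (n : ℕ) : ∀ H : SimpleGraph V, H ≤ G → H.Preconnected →
      {e ∈ H.edgeSet | H.IsBridge e}.ncard ≤ n →
      ∃ H' ≤ G, H'.IsEdgeConnected 2 ∧ numEdges H' ≤ numEdges H + n := by
  induction n with
  | zero =>
    intro H hle hconn hn
    refine ⟨H, hle, ?_, le_rfl⟩
    have hn' : {e ∈ H.edgeSet | H.IsBridge e} = ∅ :=
      (Set.ncard_eq_zero (Set.toFinite _)).1 (Nat.le_zero.1 hn)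
    rw [isEdgeConnected_two]
    intro e u v
    refine (hconn u v).deleteEdges_of_not_isBridge fun hb => ?_
    by_cases he : e ∈ H.edgeSet
    · exact Set.eq_empty_iff_forall_notMem.1 hn' e ⟨he, hb⟩
    · induction e with
      | _ x y =>
      refine hb ((hconn x y).mono fun a b hab => ?_)
      rw [deleteEdges_adj]
      refine ⟨hab, fun h => he ?_⟩
      rw [← Set.mem_singleton_iff.1 h]
      exact hab
  | succ n ih =>
    intro H hle hconn hn
    rcases Set.eq_empty_or_nonempty {e ∈ H.edgeSet | H.IsBridge e} with hemp | ⟨e, he, hb⟩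
    · obtain ⟨H', h1, h2, h3⟩ := ih H hle hconn (by rw [hemp]; simp)
      exact ⟨H', h1, h2, by omega⟩
    · induction e with
      | _ x y =>
      obtain ⟨p⟩ := isEdgeConnected_two.1 hG s(x, y) x y
      -- An edge `zt` of `G`, other than `xy`, that crosses the cut defined by the bridge `xy`.
      obtain ⟨z, t, ht, hadj, q, -, hq⟩ := p.exists_isPath_until
        (T := {v | (H.deleteEdges {s(x, y)}).Reachable y v}) (fun h => hb (Reachable.symm h)) .rfl
      have hz := (hq z q.end_mem_support).1
      change (H.deleteEdges {s(x, y)}).Reachable y t at ht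
      change ¬ (H.deleteEdges {s(x, y)}).Reachable y z at hz
      rw [deleteEdges_adj] at hadj
      have hfH : s(z, t) ∉ H.edgeSet := by
        intro hmem
        refine hz (ht.trans (Adj.reachable ?_))
        rw [deleteEdges_adj]
        refine ⟨Adj.symm hmem, fun hc => hadj.2 ?_⟩
        rw [Set.mem_singleton_iff, Sym2.eq_swap]
        exact hc
      set H' : SimpleGraph V := H ⊔ fromEdgeSet {s(z, t)} with hH'
      have hHH' : H ≤ H' := le_sup_left
      have hzt : H'.Adj z t := by
        rw [hH', sup_adj, fromEdgeSet_adj]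
        exact Or.inr ⟨rfl, hadj.1.ne⟩
      have hnb : ¬ H'.IsBridge s(x, y) := by
        intro hb'
        have hxz : (H.deleteEdges {s(x, y)}).Reachable x z := by
          rcases (hconn x y).deleteEdges_three (hconn x z) s(x, y) with h | h | h
          · exact absurd h hb
          · exact h
          · exact absurd h hz
        have hle' : H.deleteEdges {s(x, y)} ≤ H'.deleteEdges {s(x, y)} := deleteEdges_mono hHH'
        refine hb' ((hxz.mono hle').trans (Reachable.trans (Adj.reachable ?_) (ht.symm.mono hle')))
        rw [deleteEdges_adj]
        exact ⟨hzt, hadj.2⟩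
      have hsub : {e ∈ H'.edgeSet | H'.IsBridge e} ⊆
          {e ∈ H.edgeSet | H.IsBridge e} \ {s(x, y)} := by
        rintro f ⟨hf, hfb⟩
        have hfH' : f ∈ H.edgeSet := by
          by_contra hfn
          rw [hH', edgeSet_sup, edgeSet_fromEdgeSet] at hf
          have hfe : f = s(z, t) := (hf.resolve_left hfn).1
          subst hfe
          refine hfb ((hconn z t).mono fun a b hab => ?_)
          rw [deleteEdges_adj]
          refine ⟨hHH' hab, fun h => hfn ?_⟩
          rw [← Set.mem_singleton_iff.1 h]
          exact hab
        refine ⟨⟨hfH', hfb.anti hHH'⟩, fun h => ?_⟩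
        rw [Set.mem_singleton_iff] at h
        subst h
        exact hnb hfb
      have hcard : {e ∈ H'.edgeSet | H'.IsBridge e}.ncard ≤ n := by
        refine (Set.ncard_le_ncard hsub (Set.toFinite _)).trans ?_
        have hmem : s(x, y) ∈ {e ∈ H.edgeSet | H.IsBridge e} := ⟨he, hb⟩
        rw [Set.ncard_sdiff_singleton_of_mem hmem]
        omega
      have hle' : H' ≤ G := by
        refine sup_le hle ?_
        rw [fromEdgeSet_le]
        rintro f ⟨hf, -⟩
        rw [Set.mem_singleton_iff.1 hf]
        exact hadj.1
      obtain ⟨H'', h1, h2, h3⟩ := ih H' hle' (fun u v => (hconn u v).mono hHH') hcard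
      refine ⟨H'', h1, h2, h3.trans ?_⟩
      have h4 := numEdges_sup_le H (fromEdgeSet {s(z, t)})
      have h5 := numEdges_fromEdgeSet_le ({s(z, t)} : Finset (Sym2 V))
      rw [Finset.coe_singleton, Finset.card_singleton] at h5
      rw [← hH'] at h4
      omega

/-! ### Class systems and the payments of their classes -/

/-- The edges of `G` are distributed to connected classes such that any two vertices are joined
in two classes, or doubly joined in one class. -/
structure IsClassSystem {ι : Type*} (G : SimpleGraph V) (C : ι → SimpleGraph V) : Prop where
  le : ∀ i, C i ≤ G
  disj : ∀ ⦃i j u v⦄, (C i).Adj u v → (C j).Adj u v → i = j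
  nonempty : ∀ i, ∃ u v, (C i).Adj u v
  conn : ∀ ⦃i u u' v v'⦄, (C i).Adj u u' → (C i).Adj v v' → (C i).Reachable u v
  cover : ∀ u v, u ≠ v → ∃ i j, (C i).Reachable u v ∧ (C j).Reachable u v ∧
    (i = j → (C i).IsEdgeReachable 2 u v)

open Classical in
/-- The vertices that are not isolated. -/
noncomputable def spt [Fintype V] (R : SimpleGraph V) : Finset V :=
  Finset.univ.filter fun v => ∃ w, R.Adj v w

lemma mem_spt [Fintype V] {R : SimpleGraph V} {v : V} : v ∈ spt R ↔ ∃ w, R.Adj v w := by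
  simp [spt]

lemma mem_spt_of_reachable [Fintype V] {R : SimpleGraph V} {u v : V} (h : R.Reachable u v)
    (hne : u ≠ v) : u ∈ spt R := by
  obtain ⟨p⟩ := h
  cases p with
  | nil => exact absurd rfl hne
  | cons h p => exact mem_spt.2 ⟨_, h⟩

lemma IsClassSystem.reachable {ι : Type*} [Fintype V] {G : SimpleGraph V} {C : ι → SimpleGraph V}
    (h : IsClassSystem G C) {i : ι} {u v : V} (hu : u ∈ spt (C i)) (hv : v ∈ spt (C i)) :
    (C i).Reachable u v := by
  obtain ⟨u', hu'⟩ := mem_spt.1 hu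
  obtain ⟨v', hv'⟩ := mem_spt.1 hv
  exact h.conn hu' hv'

lemma IsClassSystem.one_le_numEdges {ι : Type*} [Finite V] {G : SimpleGraph V}
    {C : ι → SimpleGraph V} (h : IsClassSystem G C) (i : ι) : 1 ≤ numEdges (C i) := by
  obtain ⟨u, v, huv⟩ := h.nonempty i
  exact (Set.ncard_pos (Set.toFinite _)).2 ⟨s(u, v), huv⟩

/-- A class with fewer edges than vertices joins adjacent vertices only once. -/
lemma IsClassSystem.card_spt_le {ι : Type*} [Fintype V] {G : SimpleGraph V}
    {C : ι → SimpleGraph V} (h : IsClassSystem G C) {i : ι} {u v : V} (huv : (C i).Adj u v)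
    (h2 : (C i).IsEdgeReachable 2 u v) : (spt (C i)).card ≤ numEdges (C i) := by
  have hnb : ¬ (C i).IsBridge s(u, v) := fun hb => hb.not_isEdgeReachable_two h2
  have h1 : (spt (C i)).card ≤ numEdges ((C i).deleteEdges {s(u, v)}) + 1 :=
    card_le_numEdges_add_one fun a ha b hb =>
      (h.reachable ha hb).deleteEdges_of_not_isBridge hnb
  have h3 : numEdges ((C i).deleteEdges {s(u, v)}) = numEdges (C i) - 1 := by
    unfold numEdges
    rw [edgeSet_deleteEdges, Set.ncard_sdiff_singleton_of_mem ((C i).mem_edgeSet.2 huv)]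
  have := h.one_le_numEdges i
  omega

open Classical in
/-- The edges of the classes other than a largest one pay, beyond one edge each, for the vertices
in the largest class and for at least two edges at each other vertex. -/
lemma IsClassSystem.sum_le {ι : Type*} [Fintype ι] [Fintype V] {G : SimpleGraph V}
    {C : ι → SimpleGraph V} (h : IsClassSystem G C) {s : ι}
    (hmax : ∀ i, (spt (C i)).card ≤ (spt (C s)).card) :
    ∑ i ∈ Finset.univ.erase s, ((spt (C i) ∩ spt (C s)).card - 2) +
      ∑ z ∈ (spt (C s))ᶜ, max 2 (Finset.univ.filter fun i => i ≠ s ∧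
        2 ≤ (spt (C i) ∩ spt (C s)).card ∧ z ∈ spt (C i)).card ≤
      ∑ i ∈ Finset.univ.erase s, (numEdges (C i) - 1) := by
  set U := spt (C s) with hU
  -- A tree class with a single vertex in `U` is one edge short of paying for all its outside
  -- vertices. The one left unpaid is chosen next to the vertex in `U`.
  have hwit : ∀ i, ∃ w, (spt (C i) ∩ U).card = 1 → w ∈ spt (C i) \ U ∧
      ∀ u ∈ spt (C i) ∩ U, (C i).Adj u w := by
    intro i
    by_cases hp : (spt (C i) ∩ U).card = 1
    · obtain ⟨u, hu⟩ := Finset.card_eq_one.1 hp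
      have huU : u ∈ spt (C i) ∩ U := by rw [hu]; simp
      obtain ⟨w, hw⟩ := mem_spt.1 (Finset.mem_inter.1 huU).1
      refine ⟨w, fun _ => ⟨Finset.mem_sdiff.2 ⟨mem_spt.2 ⟨u, hw.symm⟩, fun hwU => ?_⟩, ?_⟩⟩
      · have : w ∈ spt (C i) ∩ U := Finset.mem_inter.2 ⟨mem_spt.2 ⟨u, hw.symm⟩, hwU⟩
        rw [hu, Finset.mem_singleton] at this
        exact hw.ne this.symm
      · intro u' hu'
        rw [hu, Finset.mem_singleton] at hu'
        rw [hu']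
        exact hw
    · exact ⟨Classical.choice ⟨(h.nonempty s).choose⟩, fun h => absurd h hp⟩
  choose wit hwit using hwit
  -- `rel i z`: the class `i` pays one unit for `z`.
  set rel : ι → V → Prop := fun i z => z ∈ spt (C i) ∧ 1 ≤ (spt (C i) ∩ U).card ∧
    ¬ ((spt (C i) ∩ U).card = 1 ∧ numEdges (C i) < (spt (C i)).card ∧ wit i = z) with hrel
  have hcard : ∀ i, (spt (C i) \ U).card + (spt (C i) ∩ U).card = (spt (C i)).card := fun i =>
    Finset.card_sdiff_add_card_inter _ _
  have h1 : ∀ i ∈ Finset.univ.erase s, ((spt (C i) ∩ U).card - 2) +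
      (Uᶜ.filter fun z => rel i z).card ≤ numEdges (C i) - 1 := by
    intro i _
    have e1 := h.one_le_numEdges i
    have e2 : (spt (C i)).card ≤ numEdges (C i) + 1 :=
      card_le_numEdges_add_one fun a ha b hb => h.reachable ha hb
    have e3 := hcard i
    have hsub : (Uᶜ.filter fun z => rel i z) ⊆ spt (C i) \ U := by
      intro z hz
      obtain ⟨hzU, hz⟩ := Finset.mem_filter.1 hz
      exact Finset.mem_sdiff.2 ⟨hz.1, Finset.mem_compl.1 hzU⟩
    have e4 := Finset.card_le_card hsub
    rcases Nat.lt_trichotomy (spt (C i) ∩ U).card 1 with hp | hp | hp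
    · have : (Uᶜ.filter fun z => rel i z) = ∅ := by
        refine Finset.filter_eq_empty_iff.2 fun z _ hz => ?_
        have := hz.2.1
        omega
      rw [this, Finset.card_empty]
      omega
    · by_cases he : numEdges (C i) < (spt (C i)).card
      · have hsub' : (Uᶜ.filter fun z => rel i z) ⊆ (spt (C i) \ U).erase (wit i) := by
          intro z hz
          refine Finset.mem_erase.2 ⟨?_, hsub hz⟩
          rintro rfl
          exact (Finset.mem_filter.1 hz).2.2.2 ⟨hp, he, rfl⟩
        have e5 := Finset.card_le_card hsub'
        rw [Finset.card_erase_of_mem (hwit i hp).1] at e5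
        omega
      · omega
    · omega
  have h2 : ∀ z ∈ Uᶜ, max 2 (Finset.univ.filter fun i => i ≠ s ∧
      2 ≤ (spt (C i) ∩ U).card ∧ z ∈ spt (C i)).card ≤
      ((Finset.univ.erase s).filter fun i => rel i z).card := by
    intro z hz
    have hzU := Finset.mem_compl.1 hz
    refine max_le ?_ (Finset.card_le_card ?_)
    · have hcov : ∀ u ∈ U, ∃ i ∈ (Finset.univ.erase s).filter (fun i => rel i z), u ∈ spt (C i) := by
        intro u hu
        have huz : u ≠ z := by rintro rfl; exact hzU hu
        obtain ⟨i, j, hi, hj, hij⟩ := h.cover u z huz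
        have hmem : ∀ i, (C i).Reachable u z → i ∈ Finset.univ.erase s ∧ u ∈ spt (C i) ∧
            z ∈ spt (C i) ∧ u ∈ spt (C i) ∩ U := by
          intro i hi
          have hzi := mem_spt_of_reachable hi.symm huz.symm
          have hui := mem_spt_of_reachable hi huz
          refine ⟨Finset.mem_erase.2 ⟨?_, Finset.mem_univ _⟩, hui, hzi,
            Finset.mem_inter.2 ⟨hui, hu⟩⟩
          rintro rfl
          exact hzU hzi
        have hor : ∀ i, (C i).Reachable u z → ¬ rel i z →
            (C i).Adj u z ∧ numEdges (C i) < (spt (C i)).card := by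
          intro i hi hn
          obtain ⟨m1, m2, m3, m4⟩ := hmem i hi
          have : (spt (C i) ∩ U).card = 1 ∧ numEdges (C i) < (spt (C i)).card ∧ wit i = z := by
            by_contra hc
            exact hn ⟨m3, Finset.card_pos.2 ⟨u, m4⟩, hc⟩
          obtain ⟨hp, hlt, rfl⟩ := this
          exact ⟨(hwit i hp).2 u m4, hlt⟩
        by_cases hri : rel i z
        · exact ⟨i, Finset.mem_filter.2 ⟨(hmem i hi).1, hri⟩, (hmem i hi).2.1⟩
        · by_cases hrj : rel j z
          · exact ⟨j, Finset.mem_filter.2 ⟨(hmem j hj).1, hrj⟩, (hmem j hj).2.1⟩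
          · exfalso
            obtain ⟨a1, a2⟩ := hor i hi hri
            obtain ⟨b1, b2⟩ := hor j hj hrj
            have := h.card_spt_le a1 (hij (h.disj a1 b1))
            omega
      -- A sole payer for `z` would contain `z` and all of `U`, contrary to the choice of `s`.
      by_contra hlt
      have hle : ((Finset.univ.erase s).filter fun i => rel i z).card ≤ 1 := by omega
      obtain ⟨u0, v0, huv0⟩ := h.nonempty s
      obtain ⟨i, hi, -⟩ := hcov u0 (mem_spt.2 ⟨v0, huv0⟩)
      have hall : insert z U ⊆ spt (C i) := by
        intro u hu
        rcases Finset.mem_insert.1 hu with rfl | hu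
        · exact (Finset.mem_filter.1 hi).2.1
        · obtain ⟨j, hj, huj⟩ := hcov u hu
          rw [Finset.card_le_one.1 hle i hi j hj]
          exact huj
      have := Finset.card_le_card hall
      rw [Finset.card_insert_of_notMem hzU] at this
      have := hmax i
      omega
    · intro i hi
      obtain ⟨-, his, hp, hzi⟩ := Finset.mem_filter.1 hi
      refine Finset.mem_filter.2 ⟨Finset.mem_erase.2 ⟨his, Finset.mem_univ _⟩, hzi, by omega, ?_⟩
      rintro ⟨hp', -⟩
      omega
  have h3 : ∑ z ∈ Uᶜ, ((Finset.univ.erase s).filter fun i => rel i z).card =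
      ∑ i ∈ Finset.univ.erase s, (Uᶜ.filter fun z => rel i z).card :=
    (Finset.sum_card_bipartiteAbove_eq_sum_card_bipartiteBelow rel).symm
  refine (Nat.add_le_add_left (Finset.sum_le_sum h2) _).trans ?_
  rw [h3, ← Finset.sum_add_distrib]
  exact Finset.sum_le_sum h1

/-! ### The sparse spanning subgraph of a class system -/

/-- A connected graph that meets `U` in two vertices, but has no edge inside `U`, contains an ear
of `U`. -/
lemma exists_ear_path {R : SimpleGraph V} {U : Finset V} {a b : V} (ha : a ∈ U) (hb : b ∈ U)
    (hab : a ≠ b) (hr : R.Reachable a b) (hno : ∀ u ∈ U, ∀ v ∈ U, ¬ R.Adj u v) :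
    ∃ x ∈ U, a ≠ x ∧ ∃ z z', R.Adj a z ∧ R.Adj x z' ∧ ∃ q : R.Walk z z', q.IsPath ∧
      ∀ y ∈ q.support, y ∉ U := by
  obtain ⟨p⟩ := hr
  obtain ⟨z', x, ⟨hxU, hxa⟩, hadj, q, hq, hqs⟩ := p.exists_isPath_until
    (T := {v | v ∈ U ∧ v ≠ a}) (fun h => h.2 rfl) ⟨hb, hab.symm⟩
  cases q with
  | nil => exact absurd hadj (hno _ ha _ hxU)
  | @cons _ z _ h q =>
    rw [Walk.cons_isPath_iff] at hq
    refine ⟨x, hxU, hxa.symm, z, z', h, hadj.symm, q, hq.1, fun y hy hyU => ?_⟩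
    refine (hqs y (by simp [hy])).1 ⟨hyU, ?_⟩
    rintro rfl
    exact hq.2 hy

open Classical in
/-- A graph with a class system has a sparse `2`-edge-connected spanning subgraph. -/
theorem IsClassSystem.exists_isEdgeConnected_two {ι : Type*} [Fintype ι] [Nonempty ι] [Fintype V]
    {G : SimpleGraph V} {C : ι → SimpleGraph V} (h : IsClassSystem G C)
    (hG : G.IsEdgeConnected 2) :
    ∃ H ≤ G, H.IsEdgeConnected 2 ∧ numEdges H + Fintype.card ι ≤ ∑ i, numEdges (C i) + 1 := by
  obtain ⟨s, -, hmax⟩ := Finset.exists_max_image Finset.univ (fun i => (spt (C i)).card)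
    Finset.univ_nonempty
  replace hmax : ∀ i, (spt (C i)).card ≤ (spt (C s)).card := fun i => hmax i (Finset.mem_univ _)
  have hcount := h.sum_le hmax
  set S := C s with hS
  set U := spt S with hU
  have hSU : ∀ u ∈ U, ∀ v ∈ U, S.Reachable u v := fun u hu v hv => h.reachable hu hv
  have hSmem : ∀ e ∈ S.edgeSet, ∀ v ∈ e, v ∈ U := by
    rintro e he v ⟨w, rfl⟩
    exact mem_spt.2 ⟨w, he⟩
  have hUne : U.Nonempty := by
    obtain ⟨u, v, huv⟩ := h.nonempty s
    exact ⟨u, mem_spt.2 ⟨v, huv⟩⟩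
  set Br : Finset (Sym2 V) := Finset.univ.filter fun e => e ∈ S.edgeSet ∧ S.IsBridge e with hBr
  -- The two covering classes cannot both be `s`, since `S` does not join the ends of a bridge
  -- doubly. Outside `Br` the value `s` is a dummy.
  have hτ : ∀ e : Sym2 V, ∃ i, e ∈ Br → i ≠ s ∧ ∀ v ∈ e, v ∈ spt (C i) := by
    intro e
    by_cases he : e ∈ Br
    · obtain ⟨-, he, hb⟩ := Finset.mem_filter.1 he
      induction e with
      | _ x y =>
      have hne : x ≠ y := Adj.ne he
      obtain ⟨i, j, hi, hj, hij⟩ := h.cover x y hne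
      have key : ∀ i, (C i).Reachable x y → ∀ v ∈ s(x, y), v ∈ spt (C i) := by
        intro i hi v hv
        rcases Sym2.mem_iff.1 hv with rfl | rfl
        · exact mem_spt_of_reachable hi hne
        · exact mem_spt_of_reachable hi.symm hne.symm
      by_cases his : i = s
      · refine ⟨j, fun _ => ⟨?_, key j hj⟩⟩
        rintro rfl
        subst his
        exact hb.not_isEdgeReachable_two (hij rfl)
      · exact ⟨i, fun _ => ⟨his, key i hi⟩⟩
    · exact ⟨s, fun h => absurd h he⟩
  choose τ hτ using hτ
  set E : ι → Finset (Sym2 V) := fun i => Br.filter fun e => τ e = i with hEdef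
  set A : ι → Finset V := fun i => spt (C i) ∩ U with hA
  have hE : ∀ i, ∀ e ∈ E i, e ∈ S.edgeSet ∧ S.IsBridge e ∧ ∀ v ∈ e, v ∈ A i := by
    intro i e he
    obtain ⟨heB, rfl⟩ := Finset.mem_filter.1 he
    obtain ⟨-, he, hb⟩ := Finset.mem_filter.1 heB
    exact ⟨he, hb, fun v hv => Finset.mem_inter.2 ⟨(hτ e heB).2 v hv, hSmem e he v hv⟩⟩
  have hAr : ∀ i, ∀ u ∈ A i, ∀ v ∈ A i, S.Reachable u v := fun i u hu v hv =>
    hSU u (Finset.mem_inter.1 hu).2 v (Finset.mem_inter.1 hv).2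
  set J : Finset ι := Finset.univ.filter fun i => (E i).Nonempty with hJ
  have hJs : ∀ i ∈ J, i ≠ s := by
    intro i hi
    obtain ⟨e, he⟩ := (Finset.mem_filter.1 hi).2
    obtain ⟨heB, rfl⟩ := Finset.mem_filter.1 he
    exact (hτ e heB).1
  have hEA : ∀ i ∈ J, (E i).card + 1 ≤ (A i).card := by
    intro i hi
    obtain ⟨e, he⟩ := (Finset.mem_filter.1 hi).2
    refine card_bridges_lt (hE i) ?_ (hAr i)
    induction e with
    | _ x y => exact ⟨x, (hE i _ he).2.2 x (by simp)⟩
  have hEpos : ∀ i ∈ J, 1 ≤ (E i).card := fun i hi =>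
    Finset.card_pos.2 (Finset.mem_filter.1 hi).2
  -- classes whose bridges span and that have an edge inside `U`
  set β : Finset ι := J.filter fun i => (A i).card ≤ (E i).card + 1 ∧
    ∃ a b, a ∈ U ∧ b ∈ U ∧ (C i).Adj a b with hβ
  have hchord : ∀ i, ∃ a b, i ∈ β → a ∈ U ∧ b ∈ U ∧ (C i).Adj a b := by
    intro i
    by_cases hi : i ∈ β
    · obtain ⟨-, -, a, b, hab⟩ := Finset.mem_filter.1 hi
      exact ⟨a, b, fun _ => hab⟩
    · obtain ⟨u, hu⟩ := hUne
      exact ⟨u, u, fun h => absurd h hi⟩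
  choose ca cb hchord using hchord
  set H0 : SimpleGraph V := S ⊔ fromEdgeSet ((β.image fun i => s(ca i, cb i) : Finset (Sym2 V)) :
    Set (Sym2 V)) with hH0
  have hSH0 : S ≤ H0 := le_sup_left
  have hH0e : ∀ e ∈ H0.edgeSet, e ∈ S.edgeSet ∨ ∃ i ∈ β, e = s(ca i, cb i) := by
    intro e he
    rw [hH0, edgeSet_sup, edgeSet_fromEdgeSet] at he
    refine he.imp id fun h => ?_
    obtain ⟨i, hi, rfl⟩ := Finset.mem_image.1 (Finset.mem_coe.1 h.1)
    exact ⟨i, hi, rfl⟩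
  have hH0G : H0 ≤ G := by
    refine sup_le (h.le s) ?_
    rw [fromEdgeSet_le]
    rintro e ⟨he, -⟩
    obtain ⟨i, hi, rfl⟩ := Finset.mem_image.1 (Finset.mem_coe.1 he)
    exact h.le i (hchord i hi).2.2
  have hH0U : ∀ u ∈ U, ∀ v ∈ U, H0.Reachable u v := fun u hu v hv => (hSU u hu v hv).mono hSH0
  have hH0mem : ∀ e ∈ H0.edgeSet, ∀ v ∈ e, v ∈ U := by
    intro e he v hv
    rcases hH0e e he with he | ⟨i, hi, rfl⟩
    · exact hSmem e he v hv
    · rcases Sym2.mem_iff.1 hv with rfl | rfl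
      · exact (hchord i hi).1
      · exact (hchord i hi).2.1
  have hH0num : numEdges H0 ≤ numEdges S + β.card :=
    (numEdges_sup_le _ _).trans (Nat.add_le_add_left ((numEdges_fromEdgeSet_le _).trans
      Finset.card_image_le) _)
  have hH0br : ∀ e ∈ H0.edgeSet, H0.IsBridge e → e ∈ S.edgeSet := by
    intro e he hb
    by_contra heS
    obtain ⟨i, hi, rfl⟩ := (hH0e e he).resolve_left heS
    refine hb ((hSU _ (hchord i hi).1 _ (hchord i hi).2.1).mono fun u v huv => ?_)
    rw [deleteEdges_adj]
    refine ⟨hSH0 huv, fun hc => heS ?_⟩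
    rw [← Set.mem_singleton_iff.1 hc]
    exact huv
  -- Any connection off `e` between vertices on its two sides destroys the bridge; `S'` will be `S`
  -- or `H0`.
  have hnotbr : ∀ (S' H : SimpleGraph V), S' ≤ H → S ≤ S' → ∀ i, ∀ e ∈ E i, ∀ c ∈ U, ∀ d ∈ U,
      ¬ (S'.deleteEdges {e}).Reachable c d → (H.deleteEdges {e}).Reachable c d →
      ¬ H.IsBridge e := by
    intro S' H hle hle' i e he c hc d hd hs hr hb
    have heU := hSmem e (hE i e he).1
    induction e with
    | _ x y =>
    refine hb (Reachable.of_separated hle ((hSU c hc x (heU x (by simp))).mono hle')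
      ((hSU c hc y (heU y (by simp))).mono hle') ((hSU c hc d hd).mono hle') hs hr)
  -- classes whose bridges span and that have no edge inside `U`
  have hγ : ∀ i ∈ J, (A i).card ≤ (E i).card + 1 → i ∉ β → (∃ e ∈ E i, ¬ H0.IsBridge e) ∨
      ∃ ear : Ear G H0 U, ear.e ∈ E i ∧ ear.inner ⊆ spt (C i) := by
    intro i hi hcard hiβ
    have hno : ∀ u ∈ U, ∀ v ∈ U, ¬ (C i).Adj u v := fun u hu v hv huv =>
      hiβ (Finset.mem_filter.2 ⟨hi, hcard, u, v, hu, hv, huv⟩)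
    have h2 : 1 < (A i).card := by
      have := hEA i hi
      have := hEpos i hi
      omega
    obtain ⟨a, ha, b, hb, hab⟩ := Finset.one_lt_card.1 h2
    obtain ⟨hai, haU⟩ := Finset.mem_inter.1 ha
    obtain ⟨hbi, hbU⟩ := Finset.mem_inter.1 hb
    obtain ⟨x, hxU, hax, z, z', haz, hxz, q, hq, hqU⟩ :=
      exists_ear_path haU hbU hab (h.reachable hai hbi) hno
    have hxA : x ∈ A i := Finset.mem_inter.2 ⟨mem_spt.2 ⟨z', hxz⟩, hxU⟩
    -- The bridges of `E i` are as many as a spanning tree of `A i` has edges, so one of them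
    -- separates the ends of the ear.
    obtain ⟨e, he, -, hsep⟩ := exists_far_of_card_eq (hE i) (hAr i) hcard ha hxA hax
    by_cases hsep0 : (H0.deleteEdges {e}).Reachable a x
    · exact Or.inl ⟨e, he, hnotbr S H0 hSH0 le_rfl i e he a haU x hxU hsep hsep0⟩
    · refine Or.inr ⟨⟨a, x, z, z', q.mapLe (h.le i), e, haU, hxU, h.le i haz, h.le i hxz,
        by simpa using hq, ?_, edgeSet_mono hSH0 (hE i e he).1, hsep0⟩, he, ?_⟩
      · intro y hy
        rw [Walk.support_mapLe_eq_support] at hy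
        exact hqU y hy
      · intro y hy
        have hy' : y ∈ (q.mapLe (h.le i)).support := List.mem_toFinset.1 hy
        rw [Walk.support_mapLe_eq_support] at hy'
        by_cases hyz : y = z
        · subst hyz
          exact mem_spt.2 ⟨a, haz.symm⟩
        · exact mem_spt_of_reachable ⟨(q.takeUntil y hy').reverse⟩ hyz
  set κ := {i : ι // i ∈ J ∧ ∃ ear : Ear G H0 U, ear.e ∈ E i ∧ ear.inner ⊆ spt (C i)} with hκ
  have hear : ∀ k : κ, ∃ ear : Ear G H0 U, ear.e ∈ E k.1 ∧ ear.inner ⊆ spt (C k.1) :=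
    fun k => k.2.2
  choose ear hear_e hear_in using hear
  have hinj : ∀ k ∈ (Finset.univ : Finset κ), ∀ k' ∈ (Finset.univ : Finset κ),
      (ear k).e = (ear k').e → k = k' := by
    intro k _ k' _ hkk
    have h1 := (Finset.mem_filter.1 (hear_e k)).2
    have h2 := (Finset.mem_filter.1 (hear_e k')).2
    rw [hkk] at h1
    exact Subtype.ext (h1.symm.trans h2)
  obtain ⟨H1, hH1, hnum⟩ := exists_spanning_of_ears hG hUne hH0G hH0U hH0mem Finset.univ ear hinj
  set B1 : Finset (Sym2 V) := Finset.univ.filter fun e => e ∈ H1.edgeSet ∧ H1.IsBridge e with hB1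
  have hB1Br : ∀ e ∈ B1, e ∈ Br := by
    intro e he
    obtain ⟨-, he, hb⟩ := Finset.mem_filter.1 he
    have h1 := hH1.bridge e he hb
    have hb0 := hb.anti hH1.base_le
    exact Finset.mem_filter.2 ⟨Finset.mem_univ _, hH0br e h1 hb0, hb0.anti hSH0⟩
  set O : Finset κ := Finset.univ.filter fun k => (ear k).Open H1 with hO
  set O' : Finset ι := O.image Subtype.val with hO'
  -- The account of one class: surviving bridges and the chord, if any, cost `|A i| - 2`, plus one
  -- if its ear is still open. The ear budget covers this last unit.
  have hper : ∀ i ∈ J, (B1.filter fun e => e ∈ E i).card + (if i ∈ β then 1 else 0) ≤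
      ((A i).card - 2) + if i ∈ O' then 1 else 0 := by
    intro i hi
    have e1 := hEA i hi
    have e2 := hEpos i hi
    have hsub : (B1.filter fun e => e ∈ E i) ⊆ E i := fun e he => (Finset.mem_filter.1 he).2
    by_cases hcard : (A i).card ≤ (E i).card + 1
    · by_cases hiβ : i ∈ β
      · obtain ⟨haU, hbU, hadj⟩ := hchord i hiβ
        have hnadj : ¬ S.Adj (ca i) (cb i) := fun hc => hJs i hi (h.disj hadj hc)
        obtain ⟨f, hf, f', hf', hff, hs, hs'⟩ := exists_two_separating (hE i) (hAr i) hcard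
          (Finset.mem_inter.2 ⟨mem_spt.2 ⟨_, hadj⟩, haU⟩)
          (Finset.mem_inter.2 ⟨mem_spt.2 ⟨_, hadj.symm⟩, hbU⟩) hadj.ne hnadj
        have hnb : ∀ f ∈ E i, ¬ (S.deleteEdges {f}).Reachable (ca i) (cb i) →
            f ∉ B1.filter fun e => e ∈ E i := by
          intro f hf hs hfB
          obtain ⟨-, -, hfb⟩ := Finset.mem_filter.1 (Finset.mem_filter.1 hfB).1
          refine hnotbr S H1 (hSH0.trans hH1.base_le) le_rfl i f hf _ haU _ hbU hs
            (Adj.reachable ?_) hfb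
          rw [deleteEdges_adj]
          refine ⟨hH1.base_le ?_, fun hc => hnadj ?_⟩
          · rw [hH0, sup_adj, fromEdgeSet_adj]
            exact Or.inr ⟨Finset.mem_coe.2 (Finset.mem_image.2 ⟨i, hiβ, rfl⟩), hadj.ne⟩
          · have := (hE i f hf).1
            rw [← Set.mem_singleton_iff.1 hc] at this
            exact this
        -- The chord kills two bridges: one makes up for the deficit, the other for the chord
        -- itself.
        have hsub' : (B1.filter fun e => e ∈ E i) ⊆ ((E i).erase f).erase f' := by
          intro e he
          rw [Finset.mem_erase, Finset.mem_erase]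
          refine ⟨?_, ?_, hsub he⟩
          · rintro rfl; exact hnb _ hf' hs' he
          · rintro rfl; exact hnb _ hf hs he
        have e3 := Finset.card_le_card hsub'
        rw [Finset.card_erase_of_mem (Finset.mem_erase.2 ⟨hff.symm, hf'⟩),
          Finset.card_erase_of_mem hf] at e3
        have e4 : 2 ≤ (E i).card := Finset.one_lt_card.2 ⟨f, hf, f', hf', hff⟩
        rw [if_pos hiβ]
        split_ifs <;> omega
      · rw [if_neg hiβ]
        have herase : ∀ f ∈ E i, ¬ H1.IsBridge f →
            (B1.filter fun e => e ∈ E i).card ≤ (E i).card - 1 := by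
          intro f hf hfb
          rw [← Finset.card_erase_of_mem hf]
          refine Finset.card_le_card fun e he => Finset.mem_erase.2 ⟨?_, hsub he⟩
          rintro rfl
          exact hfb (Finset.mem_filter.1 (Finset.mem_filter.1 he).1).2.2
        rcases hγ i hi hcard hiβ with ⟨f, hf, hfb⟩ | hear'
        · have := herase f hf fun hb => hfb (hb.anti hH1.base_le)
          split_ifs <;> omega
        · by_cases hOi : i ∈ O'
          · rw [if_pos hOi]
            have := Finset.card_le_card hsub
            omega
          · set k : κ := ⟨i, hi, hear'⟩ with hk
            have hko : ¬ (ear k).Open H1 := fun ho =>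
              hOi (Finset.mem_image.2 ⟨k, Finset.mem_filter.2 ⟨Finset.mem_univ _, ho⟩, rfl⟩)
            have hr : (H1.deleteEdges {(ear k).e}).Reachable (ear k).a (ear k).b := by
              by_contra hc
              exact hko hc
            have := herase _ (hear_e k) (hnotbr H0 H1 hH1.base_le hSH0 i _ (hear_e k) _
              (ear k).a_mem _ (ear k).b_mem (ear k).sep hr)
            rw [if_neg hOi]
            omega
    · have hiβ : i ∉ β := fun hc => hcard (Finset.mem_filter.1 hc).2.1
      rw [if_neg hiβ]
      have := Finset.card_le_card hsub
      split_ifs <;> omega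
  have hB1card : B1.card ≤ ∑ i ∈ J, (B1.filter fun e => e ∈ E i).card := by
    refine le_trans (Finset.card_le_card ?_) Finset.card_biUnion_le
    intro e he
    have heE : e ∈ E (τ e) := Finset.mem_filter.2 ⟨hB1Br e he, rfl⟩
    exact Finset.mem_biUnion.2 ⟨τ e, Finset.mem_filter.2 ⟨Finset.mem_univ _, e, heE⟩,
      Finset.mem_filter.2 ⟨he, heE⟩⟩
  have hsum := Finset.sum_le_sum hper
  rw [Finset.sum_add_distrib, Finset.sum_add_distrib, ← Finset.card_filter, ← Finset.card_filter]
    at hsum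
  have hβJ : (J.filter fun i => i ∈ β).card = β.card := by
    congr 1
    ext i
    rw [Finset.mem_filter, and_iff_right_iff_imp]
    exact fun hi => (Finset.mem_filter.1 hi).1
  have hOJ : (J.filter fun i => i ∈ O').card ≤ O.card := by
    refine (Finset.card_le_card (t := O') fun i hi => (Finset.mem_filter.1 hi).2).trans ?_
    exact Finset.card_image_le
  have hJsum : ∑ i ∈ J, ((A i).card - 2) ≤ ∑ i ∈ Finset.univ.erase s, ((A i).card - 2) :=
    Finset.sum_le_sum_of_subset fun i hi => Finset.mem_erase.2 ⟨hJs i hi, Finset.mem_univ _⟩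
  -- Ears through `z` come from distinct classes that contain `z` and have at least two vertices in
  -- `U`.
  have hmsum : ∑ z ∈ Uᶜ, max 2 (Finset.univ.filter fun k => z ∈ (ear k).inner).card ≤
      ∑ z ∈ Uᶜ, max 2 (Finset.univ.filter fun i => i ≠ s ∧ 2 ≤ (A i).card ∧
        z ∈ spt (C i)).card := by
    refine Finset.sum_le_sum fun z _ => max_le_max le_rfl ?_
    refine Finset.card_le_card_of_injOn Subtype.val ?_ Subtype.val_injective.injOn
    intro k hk
    have hk' := (Finset.mem_filter.1 hk).2
    have := hEA k.1 k.2.1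
    have := hEpos k.1 k.2.1
    exact Finset.mem_coe.2 (Finset.mem_filter.2 ⟨Finset.mem_univ _, hJs k.1 k.2.1, by omega,
      hear_in k hk'⟩)
  have hbr : {e ∈ H1.edgeSet | H1.IsBridge e}.ncard ≤ B1.card := by
    rw [← Set.ncard_coe_finset]
    refine Set.ncard_le_ncard (fun e he => ?_) (Set.toFinite _)
    exact Finset.mem_coe.2 (Finset.mem_filter.2 ⟨Finset.mem_univ _, he.1, he.2⟩)
  obtain ⟨H, hHG, hH2, hHnum⟩ := exists_isEdgeConnected_two_of_bridges hG B1.card H1 hH1.le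
    (fun u v => hH1.reach u (Finset.mem_univ _) v (Finset.mem_univ _)) hbr
  refine ⟨H, hHG, hH2, ?_⟩
  have hcost : ∑ i ∈ Finset.univ.erase s, (numEdges (C i) - 1) + Fintype.card ι =
      ∑ i ∈ Finset.univ.erase s, numEdges (C i) + 1 := by
    have : ∑ i ∈ Finset.univ.erase s, (numEdges (C i) - 1) + (Finset.univ.erase s).card =
        ∑ i ∈ Finset.univ.erase s, numEdges (C i) := by
      rw [Finset.card_eq_sum_ones, ← Finset.sum_add_distrib]
      exact Finset.sum_congr rfl fun i _ => Nat.sub_add_cancel (h.one_le_numEdges i)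
    rw [← this, ← Finset.card_univ, add_assoc, Finset.card_erase_add_one (Finset.mem_univ s)]
  have htot := Finset.sum_erase_add Finset.univ (fun i => numEdges (C i)) (Finset.mem_univ s)
  rw [← hS] at htot
  have hcount' : ∑ i ∈ Finset.univ.erase s, ((A i).card - 2) +
      ∑ z ∈ Uᶜ, max 2 (Finset.univ.filter fun i => i ≠ s ∧ 2 ≤ (A i).card ∧
        z ∈ spt (C i)).card ≤ ∑ i ∈ Finset.univ.erase s, (numEdges (C i) - 1) := hcount
  clear hcount
  omega

/-! ### Two edge-disjoint walks -/

/-- A path from `w` can use `vw` only as its first edge. Without that edge it starts at `v`, and the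
edge is free to prolong the other walk. -/
lemma exists_disjoint_walks_of_mem {H : SimpleGraph V} {u v w : V} (h : H.Adj v w)
    {p q : H.Walk w u} (hq : q.IsPath) (hd : List.Disjoint p.edges q.edges)
    (he : s(v, w) ∈ q.edges) :
    ∃ p' q' : H.Walk v u, List.Disjoint p'.edges q'.edges := by
  cases q with
  | nil => simp at he
  | @cons _ a _ h' q =>
    rw [Walk.cons_isPath_iff] at hq
    have hwq : ∀ t, s(t, w) ∉ q.edges := fun t ht => hq.2 (q.snd_mem_support_of_mem_edges ht)
    rw [Walk.edges_cons, List.mem_cons] at he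
    have hav := he.resolve_right (hwq v)
    have hva : v = a := by
      rcases Sym2.eq_iff.1 hav with ⟨rfl, -⟩ | ⟨h1, -⟩
      · exact absurd h H.irrefl
      · exact h1
    subst hva
    refine ⟨p.cons h, q, ?_⟩
    rw [Walk.edges_cons, List.disjoint_cons_left]
    refine ⟨hwq v, fun e he he' => hd he ?_⟩
    rw [Walk.edges_cons]
    exact List.mem_cons_of_mem _ he'

/-- Follow the detour `t` to `x` and continue along `p`; the second walk takes `vw` and then `q`. -/
lemma exists_disjoint_walks_of_hit {H : SimpleGraph V} {u v w x : V} (h : H.Adj v w)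
    {p q : H.Walk w u} (hd : List.Disjoint p.edges q.edges) (hep : s(v, w) ∉ p.edges)
    (hx : x ∈ p.support) (t : H.Walk v x) (het : s(v, w) ∉ t.edges)
    (ht : ∀ y ∈ t.support, y ∈ p.support ∨ y ∈ q.support → y = x) :
    ∃ p' q' : H.Walk v u, List.Disjoint p'.edges q'.edges := by
  classical
  have hdrop : ∀ e, e ∈ (p.dropUntil x hx).edges → e ∈ p.edges := fun e he =>
    p.edges_dropUntil_subset_edges hx he
  refine ⟨q.cons h, t.append (p.dropUntil x hx), ?_⟩
  rw [Walk.edges_cons, Walk.edges_append, List.disjoint_cons_left, List.disjoint_append_right]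
  refine ⟨?_, ?_, fun e he he' => hd (hdrop e he') he⟩
  · rw [List.mem_append, not_or]
    exact ⟨het, fun h => hep (hdrop _ h)⟩
  · intro e heq het'
    induction e with
    | _ a b =>
    have ha := ht a (t.fst_mem_support_of_mem_edges het')
      (Or.inr (q.fst_mem_support_of_mem_edges heq))
    have hb := ht b (t.snd_mem_support_of_mem_edges het')
      (Or.inr (q.snd_mem_support_of_mem_edges heq))
    have := t.adj_of_mem_edges het'
    rw [ha, hb] at this
    exact H.irrefl this

/-- In a `2`-edge-connected graph, any two vertices are joined by two edge-disjoint walks. -/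
lemma IsEdgeConnected.exists_disjoint_walks {H : SimpleGraph V} (hH : H.IsEdgeConnected 2)
    (v u : V) : ∃ p q : H.Walk v u, List.Disjoint p.edges q.edges := by
  classical
  obtain ⟨r⟩ := hH.preconnected (by norm_num) v u
  induction r with
  | nil => exact ⟨.nil, .nil, by simp⟩
  | @cons v w u h r ih =>
    obtain ⟨p0, q0, hd0⟩ := ih
    obtain ⟨p, q, hp, hq, hd⟩ : ∃ p q : H.Walk w u, p.IsPath ∧ q.IsPath ∧
        List.Disjoint p.edges q.edges :=
      ⟨p0.bypass, q0.bypass, p0.bypass_isPath, q0.bypass_isPath, fun e he he' =>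
        hd0 (p0.edges_bypass_subset_edges he) (q0.edges_bypass_subset_edges he')⟩
    by_cases heq : s(v, w) ∈ q.edges
    · exact exists_disjoint_walks_of_mem h hq hd heq
    by_cases hep : s(v, w) ∈ p.edges
    · exact exists_disjoint_walks_of_mem h hp hd.symm hep
    obtain ⟨t0⟩ := isEdgeConnected_two.1 hH s(v, w) v w
    obtain ⟨x, hx, t, -, ht⟩ := t0.exists_isPath_first
      (T := {y | y ∈ p.support ∨ y ∈ q.support}) (Or.inl p.start_mem_support)
    have het : s(v, w) ∉ (t.mapLe (deleteEdges_le _)).edges := by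
      intro he
      rw [Walk.edges_mapLe_eq_edges] at he
      have := t.edges_subset_edgeSet he
      rw [edgeSet_deleteEdges] at this
      exact this.2 rfl
    have ht' : ∀ y ∈ (t.mapLe (deleteEdges_le _)).support, y ∈ p.support ∨ y ∈ q.support →
        y = x := by
      intro y hy
      rw [Walk.support_mapLe_eq_support] at hy
      exact (ht y hy).2
    rcases hx with hx | hx
    · exact exists_disjoint_walks_of_hit h hd hep hx _ het ht'
    · exact exists_disjoint_walks_of_hit h hd.symm heq hx _ het fun y hy hyy =>
        ht' y hy hyy.symm

/-! ### Color classes -/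

/-- The graph formed by the edges of color `c`. -/
def colorGraph {D : Type*} {G : SimpleGraph V} (Γ : G.edgeSet → D) (c : D) : SimpleGraph V :=
  fromEdgeSet {e | ∃ h : e ∈ G.edgeSet, Γ ⟨e, h⟩ = c}

lemma mem_edgeSet_colorGraph {D : Type*} {G : SimpleGraph V} {Γ : G.edgeSet → D} {c : D}
    {e : Sym2 V} : e ∈ (colorGraph Γ c).edgeSet ↔ ∃ h : e ∈ G.edgeSet, Γ ⟨e, h⟩ = c := by
  rw [colorGraph, edgeSet_fromEdgeSet]
  refine ⟨fun h => h.1, fun h => ⟨h, G.not_isDiag_of_mem_edgeSet h.1⟩⟩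

lemma colorGraph_le {D : Type*} {G : SimpleGraph V} (Γ : G.edgeSet → D) (c : D) :
    colorGraph Γ c ≤ G := by
  rw [← edgeSet_subset_edgeSet]
  exact fun e he => (mem_edgeSet_colorGraph.1 he).1

/-- A monochromatic walk between distinct vertices lies in a color class. -/
lemma IsMonochromatic.exists_color {D : Type*} {G : SimpleGraph V} {Γ : G.edgeSet → D} {u v : V}
    {p : G.Walk u v} (hp : IsMonochromatic Γ p) (huv : u ≠ v) :
    ∃ c, ∀ e ∈ p.edges, e ∈ (colorGraph Γ c).edgeSet := by
  cases p with
  | nil => exact absurd rfl huv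
  | @cons _ w _ h p =>
    refine ⟨Γ ⟨s(u, w), h⟩, fun e he => mem_edgeSet_colorGraph.2 ?_⟩
    refine ⟨Walk.edges_subset_edgeSet _ he, hp _ _ he ?_⟩
    simp

lemma sum_numEdges_colorGraph_le {D : Type*} [Fintype D] [Finite V] {G : SimpleGraph V}
    (Γ : G.edgeSet → D) : ∑ c, numEdges (colorGraph Γ c) ≤ numEdges G := by
  classical
  have := Fintype.ofFinite V
  have h1 : ∀ c, numEdges (colorGraph Γ c) = (colorGraph Γ c).edgeFinset.card := fun c => by
    rw [numEdges, ← coe_edgeFinset, Set.ncard_coe_finset]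
  have h2 : numEdges G = G.edgeFinset.card := by
    rw [numEdges, ← coe_edgeFinset, Set.ncard_coe_finset]
  rw [h2, Finset.sum_congr rfl fun c _ => h1 c, ← Finset.card_biUnion]
  · refine Finset.card_le_card fun e he => ?_
    obtain ⟨c, -, hc⟩ := Finset.mem_biUnion.1 he
    exact mem_edgeFinset.2 (edgeSet_mono (colorGraph_le Γ c) (mem_edgeFinset.1 hc))
  · intro c _ d _ hcd
    refine Finset.disjoint_left.2 fun e he he' => hcd ?_
    obtain ⟨h1, rfl⟩ := mem_edgeSet_colorGraph.1 (mem_edgeFinset.1 he)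
    obtain ⟨h2, rfl⟩ := mem_edgeSet_colorGraph.1 (mem_edgeFinset.1 he')
    rfl

/-- Colors split into the connected components of the color classes. -/
noncomputable def splitColoring {D : Type*} {G : SimpleGraph V} (Γ : G.edgeSet → D)
    (e : G.edgeSet) : Σ c, (colorGraph Γ c).ConnectedComponent :=
  ⟨Γ e, (colorGraph Γ (Γ e)).connectedComponentMk (Quot.out e.1).1⟩

/-- The end picked by `Quot.out` is immaterial: both ends lie in the same component. -/
lemma splitColoring_eq {D : Type*} {G : SimpleGraph V} {Γ : G.edgeSet → D} {e : G.edgeSet}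
    {c : D} (hc : Γ e = c) {u : V} (hu : u ∈ e.1) :
    splitColoring Γ e = ⟨c, (colorGraph Γ c).connectedComponentMk u⟩ := by
  subst hc
  unfold splitColoring
  congr 1
  rw [ConnectedComponent.eq]
  obtain ⟨e, he⟩ := e
  simp only at hu ⊢
  have hmk : s((Quot.out e).1, (Quot.out e).2) = e := Quot.out_eq e
  have hadj : (colorGraph Γ (Γ ⟨e, he⟩)).Adj (Quot.out e).1 (Quot.out e).2 := by
    rw [← mem_edgeSet, hmk]
    exact mem_edgeSet_colorGraph.2 ⟨he, rfl⟩
  rw [← hmk, Sym2.mem_iff] at hu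
  rcases hu with hu | hu
  · rw [hu]
  · rw [hu]
    exact hadj.reachable

lemma mem_edgeSet_split_of_walk {D : Type*} {G : SimpleGraph V} {Γ : G.edgeSet → D} {c : D}
    {u v : V} (p : (colorGraph Γ c).Walk u v) {e : Sym2 V} (he : e ∈ p.edges) :
    e ∈ (colorGraph (splitColoring Γ)
      ⟨c, (colorGraph Γ c).connectedComponentMk u⟩).edgeSet := by
  obtain ⟨h, hc⟩ := mem_edgeSet_colorGraph.1 (p.edges_subset_edgeSet he)
  refine mem_edgeSet_colorGraph.2 ⟨h, ?_⟩
  induction e with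
  | _ a b =>
  rw [splitColoring_eq hc (u := a) (by simp)]
  congr 1
  rw [ConnectedComponent.eq]
  classical
  exact ⟨(p.takeUntil a (p.fst_mem_support_of_mem_edges he)).reverse⟩

/-- A monochromatic path stays within one component of its color. If both paths fall in the same
class, deleting an edge leaves one of them intact. -/
lemma isClassSystem_split {D : Type*} {G : SimpleGraph V} {Γ : G.edgeSet → D}
    (hΓ : IsMCColoring 2 Γ) :
    IsClassSystem G fun i : Set.range (splitColoring Γ) => colorGraph (splitColoring Γ) i.1 where
  le i := colorGraph_le _ _
  disj := by
    intro i j u v hi hj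
    rw [← mem_edgeSet] at hi hj
    obtain ⟨h1, h2⟩ := mem_edgeSet_colorGraph.1 hi
    obtain ⟨h3, h4⟩ := mem_edgeSet_colorGraph.1 hj
    exact Subtype.ext (h2.symm.trans h4)
  nonempty := by
    rintro ⟨-, ⟨e, he⟩, rfl⟩
    induction e with
    | _ a b => exact ⟨a, b, mem_edgeSet_colorGraph.2 ⟨he, rfl⟩⟩
  conn := by
    rintro ⟨⟨c, K⟩, hi⟩ u u' v v' huu hvv
    simp only at huu hvv ⊢
    have key : ∀ {a b : V}, (colorGraph (splitColoring Γ) ⟨c, K⟩).Adj a b →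
        (colorGraph Γ c).connectedComponentMk a = K := by
      intro a b hab
      rw [← mem_edgeSet] at hab
      obtain ⟨h, hc⟩ := mem_edgeSet_colorGraph.1 hab
      have hc' : Γ ⟨s(a, b), h⟩ = c := congrArg Sigma.fst hc
      rw [splitColoring_eq hc' (u := a) (by simp)] at hc
      simpa using hc
    have h1 := key huu
    have h2 := key hvv
    rw [← h2, ConnectedComponent.eq] at h1
    obtain ⟨p⟩ := h1
    rw [← key huu]
    exact ⟨p.transfer _ fun e he => mem_edgeSet_split_of_walk p he⟩
  cover := by
    intro u v huv
    obtain ⟨P, hmono, hdisj⟩ := hΓ u v huv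
    have key : ∀ t, ∃ i : Set.range (splitColoring Γ),
        ∃ p : (colorGraph (splitColoring Γ) i.1).Walk u v, p.edges = (P t : G.Walk u v).edges := by
      intro t
      obtain ⟨c, hc⟩ := (hmono t).exists_color huv
      set p := (P t : G.Walk u v).transfer _ hc with hp
      have hpe : p.edges = (P t : G.Walk u v).edges := Walk.edges_transfer _ _
      have hmem : (⟨c, (colorGraph Γ c).connectedComponentMk u⟩ :
          Σ c, (colorGraph Γ c).ConnectedComponent) ∈ Set.range (splitColoring Γ) := by
        obtain ⟨e, he⟩ : ∃ e, e ∈ p.edges := by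
          cases p with
          | nil => exact absurd rfl huv
          | @cons _ w _ h p => exact ⟨s(u, w), by simp⟩
        obtain ⟨h, hh⟩ := mem_edgeSet_colorGraph.1 (mem_edgeSet_split_of_walk p he)
        exact ⟨_, hh⟩
      refine ⟨⟨_, hmem⟩, p.transfer _ fun e he => mem_edgeSet_split_of_walk p he, ?_⟩
      rw [Walk.edges_transfer, hpe]
    obtain ⟨i, p, hp⟩ := key 0
    obtain ⟨j, q, hq⟩ := key 1
    refine ⟨i, j, p.reachable, q.reachable, ?_⟩
    rintro rfl
    rw [isEdgeReachable_two]
    intro e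
    by_cases he : e ∈ p.edges
    · refine (q.toDeleteEdge e fun he' => ?_).reachable
      rw [hp] at he
      rw [hq] at he'
      exact hdisj 0 1 (by decide) he he'
    · exact (p.toDeleteEdge e he).reachable

/-- The sparse `2`-edge-connected spanning subgraph obtained from a coloring. -/
theorem exists_isEdgeConnected_two_of_coloring [Finite V] [Nontrivial V] {G : SimpleGraph V}
    (hG : G.IsEdgeConnected 2) {r : ℕ} {Γ : G.edgeSet → Fin r} (hsurj : Function.Surjective Γ)
    (hΓ : IsMCColoring 2 Γ) :
    ∃ H ≤ G, H.IsEdgeConnected 2 ∧ numEdges H + r ≤ numEdges G + 1 := by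
  classical
  have := Fintype.ofFinite V
  have : Fintype (Set.range (splitColoring Γ)) := Fintype.ofFinite _
  have hne : Nonempty (Set.range (splitColoring Γ)) := by
    obtain ⟨u, v, huv⟩ := exists_pair_ne V
    obtain ⟨i, -⟩ := (isClassSystem_split hΓ).cover u v huv
    exact ⟨i⟩
  obtain ⟨H, hle, h2, hnum⟩ := (isClassSystem_split hΓ).exists_isEdgeConnected_two hG
  refine ⟨H, hle, h2, ?_⟩
  have h3 : ∑ i : Set.range (splitColoring Γ), numEdges (colorGraph (splitColoring Γ) i.1) ≤
      numEdges G := by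
    have h4 := sum_numEdges_colorGraph_le (Set.rangeFactorization (splitColoring Γ))
    refine le_trans (le_of_eq (Finset.sum_congr rfl fun i _ => ?_)) h4
    congr 1
    rw [← edgeSet_inj]
    ext e
    rw [mem_edgeSet_colorGraph, mem_edgeSet_colorGraph]
    exact exists_congr fun h => ⟨fun hh => Subtype.ext hh, fun hh => congrArg Subtype.val hh⟩
  have h5 : r ≤ Fintype.card (Set.range (splitColoring Γ)) := by
    have : Function.Surjective fun i : Set.range (splitColoring Γ) => i.1.1 := by
      intro c
      obtain ⟨e, rfl⟩ := hsurj c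
      exact ⟨⟨_, e, rfl⟩, rfl⟩
    simpa using Fintype.card_le_of_surjective _ this
  omega

/-! ### Colorings from edge-connected color classes -/

/-- If `m` colors have `2`-edge-connected classes, any two vertices are joined by `2m` edge-disjoint
monochromatic paths. -/
lemma isMCColoring_of_colorGraph {D : Type*} {G : SimpleGraph V} {Γ : G.edgeSet → D} {m : ℕ}
    (f : Fin m → D) (hf : Function.Injective f)
    (h : ∀ c, (colorGraph Γ (f c)).IsEdgeConnected 2) : IsMCColoring (2 * m) Γ := by
  classical
  intro u v huv
  have key : ∀ c, ∃ p : Fin 2 → (colorGraph Γ (f c)).Walk u v,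
      ∀ i j, i ≠ j → List.Disjoint (p i).edges (p j).edges := by
    intro c
    obtain ⟨p, q, hd⟩ := (h c).exists_disjoint_walks u v
    refine ⟨![p, q], fun i j hij => ?_⟩
    fin_cases i <;> fin_cases j
    · exact absurd rfl hij
    · exact hd
    · exact hd.symm
    · exact absurd rfl hij
  choose p hp using key
  have hedge : ∀ c i, ∀ e ∈ (((p c i).mapLe (colorGraph_le Γ (f c))).toPath : G.Walk u v).edges,
      e ∈ (p c i).edges := by
    intro c i e he
    have := Walk.edges_toPath_subset_edges _ he
    rwa [Walk.edges_mapLe_eq_edges] at this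
  have hcol : ∀ c i, ∀ e ∈ (p c i).edges, ∃ h : e ∈ G.edgeSet, Γ ⟨e, h⟩ = f c := fun c i e he =>
    mem_edgeSet_colorGraph.1 ((p c i).edges_subset_edgeSet he)
  refine ⟨fun t => ((p (finProdFinEquiv.symm t).2 (finProdFinEquiv.symm t).1).mapLe
    (colorGraph_le Γ _)).toPath, ?_, ?_⟩
  · rintro t e e' he he'
    obtain ⟨_, h1⟩ := hcol _ _ _ (hedge _ _ _ he)
    obtain ⟨_, h2⟩ := hcol _ _ _ (hedge _ _ _ he')
    exact h1.trans h2.symm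
  · intro t t' htt e he he'
    have h1 := hedge _ _ _ he
    have h2 := hedge _ _ _ he'
    obtain ⟨_, c1⟩ := hcol _ _ _ h1
    obtain ⟨_, c2⟩ := hcol _ _ _ h2
    have hc := hf (c1.symm.trans c2)
    have hne : finProdFinEquiv.symm t ≠ finProdFinEquiv.symm t' :=
      fun h => htt (finProdFinEquiv.symm.injective h)
    clear he he' c1 c2
    generalize finProdFinEquiv.symm t = x at h1 hc hne
    generalize finProdFinEquiv.symm t' = y at h2 hc hne
    obtain ⟨i, c⟩ := x
    obtain ⟨i', c'⟩ := y
    simp only at hc h1 h2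
    subst hc
    refine hp c i i' ?_ h1 h2
    rintro rfl
    exact hne rfl

/-! ### The number `mc` and the formula for two paths -/

lemma mem_mcColorCounts {D : Type*} [Finite D] {G : SimpleGraph V} {k : ℕ} {Γ : G.edgeSet → D}
    (hsurj : Function.Surjective Γ) (hΓ : IsMCColoring k Γ) : Nat.card D ∈ mcColorCounts G k := by
  refine ⟨(Finite.equivFin D) ∘ Γ, (Finite.equivFin D).surjective.comp hsurj, fun u v huv => ?_⟩
  obtain ⟨P, hP, hd⟩ := hΓ u v huv
  exact ⟨P, fun i e f he hf => congrArg (Finite.equivFin D) (hP i e f he hf), hd⟩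

lemma mc_eq_of_isGreatest {G : SimpleGraph V} {k r : ℕ} (h : IsGreatest (mcColorCounts G k) r) :
    mc G k = r := h.csSup_eq

/-- A `k`-edge-connected subgraph contains a minimal one. -/
lemma exists_isMinimalECSpanning [Finite V] {G H : SimpleGraph V} {k : ℕ} (hle : H ≤ G)
    (hH : H.IsEdgeConnected k) : ∃ H' ≤ H, IsMinimalECSpanning G k H' := by
  have hfin : Finite (SimpleGraph V) :=
    Finite.of_injective (fun H : SimpleGraph V => H.edgeSet) fun _ _ h => edgeSet_inj.1 h
  obtain ⟨H', hle', hmin⟩ := exists_minimal_le_of_wellFoundedLT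
    (fun H : SimpleGraph V => H ≤ G ∧ H.IsEdgeConnected k) H ⟨hle, hH⟩
  refine ⟨H', hle', hmin.prop.1, hmin.prop.2, fun e he hdel => ?_⟩
  have := hmin.le_of_le ⟨(deleteEdges_le _).trans hmin.prop.1, hdel⟩ (deleteEdges_le _)
  have := edgeSet_mono this he
  rw [edgeSet_deleteEdges] at this
  exact this.2 rfl

/-- The formula for `k = 2`. -/
theorem mcFormula_two [Finite V] [Nontrivial V] {G : SimpleGraph V} (hG : G.IsEdgeConnected 2) :
    MCFormula G 2 := by
  classical
  rintro H ⟨⟨hle, h2, -⟩, hmin⟩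
  have hsub : H.edgeSet ⊆ G.edgeSet := edgeSet_mono hle
  have hnum : numEdges H ≤ numEdges G := numEdges_mono hle
  have hgreat : IsGreatest (mcColorCounts G 2) (numEdges G - numEdges H + 1) := by
    constructor
    · set Γ : G.edgeSet → Option (G.edgeSet \ H.edgeSet : Set (Sym2 V)) := fun e =>
        if h : e.1 ∈ H.edgeSet then none else some ⟨e.1, e.2, h⟩ with hΓ
      have hcg : colorGraph Γ none = H := by
        rw [← edgeSet_inj]
        ext e
        rw [mem_edgeSet_colorGraph]
        constructor
        · rintro ⟨he, hh⟩
          by_contra hn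
          simp [hΓ, hn] at hh
        · intro he
          exact ⟨hsub he, by simp [hΓ, he]⟩
      have hmc : IsMCColoring (2 * 1) Γ := isMCColoring_of_colorGraph (fun _ : Fin 1 => none)
        (fun i j _ => Subsingleton.elim i j) fun _ => by rw [hcg]; exact h2
      have hsurj : Function.Surjective Γ := by
        rintro (_ | ⟨e, he⟩)
        · obtain ⟨u, v, huv⟩ := exists_pair_ne V
          obtain ⟨p⟩ := h2.preconnected (by norm_num) u v
          cases p with
          | nil => exact absurd rfl huv
          | @cons _ w _ h p =>
            exact ⟨⟨s(u, w), hsub h⟩, by simp [hΓ, h]⟩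
        · exact ⟨⟨e, he.1⟩, by simp [hΓ, he.2]⟩
      have hcard := mem_mcColorCounts hsurj hmc
      have hc : Nat.card (Option (G.edgeSet \ H.edgeSet : Set (Sym2 V))) =
          numEdges G - numEdges H + 1 := by
        rw [Finite.card_option, Nat.card_coe_set_eq, Set.ncard_sdiff hsub (Set.toFinite _)]
        rfl
      rw [hc] at hcard
      exact hcard
    · rintro r ⟨Γ, hsurj, hΓ⟩
      obtain ⟨H1, hle1, h21, hnum1⟩ := exists_isEdgeConnected_two_of_coloring hG hsurj hΓ
      obtain ⟨H2, hle2, hmin2⟩ := exists_isMinimalECSpanning hle1 h21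
      have h3 := hmin H2 hmin2
      have h4 := numEdges_mono hle2
      omega
  rw [mc_eq_of_isGreatest hgreat]
  push_cast [hnum]
  norm_num

/-! ### Vertices of degree `k` -/

/-- Fewer than `k` deleted edges miss one of `k` edge-disjoint paths. -/
lemma IsMCColoring.isEdgeConnected {D : Type*} {G : SimpleGraph V} {k : ℕ} {Γ : G.edgeSet → D}
    (hΓ : IsMCColoring k Γ) : G.IsEdgeConnected k := by
  intro u v s hs
  by_cases huv : u = v
  · rw [huv]
  obtain ⟨P, -, hd⟩ := hΓ u v huv
  by_contra hn
  have hit : ∀ i, ∃ e : s, (e : Sym2 V) ∈ (P i : G.Walk u v).edges := by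
    intro i
    by_contra! h
    exact hn ((P i : G.Walk u v).toDeleteEdges s fun e he hes => h ⟨e, hes⟩ he).reachable
  choose e he using hit
  have hinj : Function.Injective e := fun i j hij => by
    by_contra hne
    exact hd i j hne (he i) (hij ▸ he j)
  have := ENat.card_le_card_of_injective hinj
  rw [ENat.card_coe_set_eq] at this
  rw [ENat.card_eq_coe_fintype_card, Fintype.card_fin] at this
  exact absurd hs (not_lt.2 this)

/-- At a vertex of degree `k`, each edge begins one of `k` edge-disjoint monochromatic walks. -/
lemma IsMCColoring.exists_walks {D : Type*} [Finite V] {G : SimpleGraph V} {k : ℕ}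
    {Γ : G.edgeSet → D} (hΓ : IsMCColoring k Γ) {u v : V} (huv : u ≠ v)
    (hu : (G.neighborSet u).ncard = k) :
    ∃ p : G.neighborSet u → G.Walk u v, (∀ w, s(u, w.1) ∈ (p w).edges) ∧
      (∀ w, IsMonochromatic Γ (p w)) ∧ ∀ w w', w ≠ w' → List.Disjoint (p w).edges (p w').edges := by
  obtain ⟨P, hm, hd⟩ := hΓ u v huv
  have hnn : ∀ i, ¬ (P i : G.Walk u v).Nil := fun i => Walk.not_nil_of_ne huv
  have hmem : ∀ i, s(u, (P i : G.Walk u v).snd) ∈ (P i : G.Walk u v).edges := fun i =>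
    Walk.mk_start_snd_mem_edges (hnn i)
  set g : Fin k → G.neighborSet u := fun i => ⟨(P i : G.Walk u v).snd, Walk.adj_snd (hnn i)⟩
  have hinj : Function.Injective g := fun i j hij => by
    by_contra hne
    have h1 : (P i : G.Walk u v).snd = (P j : G.Walk u v).snd := congrArg Subtype.val hij
    exact hd i j hne (hmem i) (h1 ▸ hmem j)
  -- The `k` paths have distinct first edges, and `u` has only `k` edges.
  have hbij : Function.Bijective g := hinj.bijective_of_nat_card_le (by
    rw [Nat.card_coe_set_eq, hu, Nat.card_fin])
  choose i hi using hbij.surjective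
  refine ⟨fun w => P (i w), fun w => ?_, fun w => hm _, fun w w' hne => hd _ _ fun h => hne ?_⟩
  · have := hmem (i w)
    have h2 : (P (i w) : G.Walk u v).snd = w := congrArg Subtype.val (hi w)
    rwa [h2] at this
  · rw [← hi w, ← hi w', h]

lemma adj_colorGraph {D : Type*} {G : SimpleGraph V} {Γ : G.edgeSet → D} {c : D} {u v : V} :
    (colorGraph Γ c).Adj u v ↔ ∃ h : G.Adj u v, Γ ⟨s(u, v), h⟩ = c := by
  rw [← mem_edgeSet, mem_edgeSet_colorGraph]
  rfl

lemma IsMonochromatic.edges_subset {D : Type*} {G : SimpleGraph V} {Γ : G.edgeSet → D} {u v a b : V}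
    {p : G.Walk u v} (hp : IsMonochromatic Γ p) {c : D} (h : (colorGraph Γ c).Adj a b)
    (hab : s(a, b) ∈ p.edges) : ∀ e ∈ p.edges, e ∈ (colorGraph Γ c).edgeSet := by
  intro e he
  obtain ⟨h1, rfl⟩ := adj_colorGraph.1 h
  exact mem_edgeSet_colorGraph.2 ⟨p.edges_subset_edgeSet he, hp _ _ he hab⟩

/-- A vertex of degree `k` meets at most as many edges of a color as any other vertex. -/
lemma IsMCColoring.ncard_neighborSet_le {D : Type*} [Finite V] {G : SimpleGraph V} {k : ℕ}
    {Γ : G.edgeSet → D} (hΓ : IsMCColoring k Γ) {u v : V} (huv : u ≠ v)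
    (hu : (G.neighborSet u).ncard = k) (c : D) :
    ((colorGraph Γ c).neighborSet u).ncard ≤ ((colorGraph Γ c).neighborSet v).ncard := by
  obtain ⟨p, hp, hm, hd⟩ := hΓ.exists_walks huv hu
  have hcol : ∀ w : (colorGraph Γ c).neighborSet u, ∀ e ∈ (p ⟨w.1, colorGraph_le Γ c w.2⟩).edges,
      e ∈ (colorGraph Γ c).edgeSet := fun w =>
    (hm _).edges_subset w.2 (hp ⟨w.1, colorGraph_le Γ c w.2⟩)
  have hlast : ∀ w, s((p w).penultimate, v) ∈ (p w).edges := fun w =>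
    Walk.mk_penultimate_end_mem_edges (Walk.not_nil_of_ne huv)
  rw [← Nat.card_coe_set_eq, ← Nat.card_coe_set_eq]
  refine Nat.card_le_card_of_injective (fun w : (colorGraph Γ c).neighborSet u =>
    (⟨(p ⟨w.1, colorGraph_le Γ c w.2⟩).penultimate, ?_⟩ : (colorGraph Γ c).neighborSet v)) ?_
  · exact ((mem_edgeSet _).1 (hcol w _ (hlast _))).symm
  · intro w w' hww
    by_contra hne
    have h1 := congrArg Subtype.val hww
    simp only at h1
    refine hd ⟨w.1, colorGraph_le Γ c w.2⟩ ⟨w'.1, colorGraph_le Γ c w'.2⟩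
      (fun h => hne (Subtype.ext (Subtype.mk.inj h))) (hlast _) ?_
    rw [h1]
    exact hlast _

/-- A color seen at a vertex of degree `k` joins it to every vertex. -/
lemma IsMCColoring.reachable_colorGraph {D : Type*} [Finite V] {G : SimpleGraph V} {k : ℕ}
    {Γ : G.edgeSet → D} (hΓ : IsMCColoring k Γ) {u w : V}
    (hu : (G.neighborSet u).ncard = k) {c : D} (h : (colorGraph Γ c).Adj u w) (v : V) :
    (colorGraph Γ c).Reachable u v := by
  by_cases huv : u = v
  · rw [huv]
  obtain ⟨p, hp, hm, -⟩ := hΓ.exists_walks huv hu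
  exact ⟨(p ⟨w, colorGraph_le Γ c h⟩).transfer _ ((hm _).edges_subset h (hp _))⟩

lemma Reachable.mem_of_adj_closed {H : SimpleGraph V} {S : Set V} {u v : V} (h : H.Reachable u v)
    (hu : u ∈ S) (hS : ∀ a ∈ S, ∀ b, H.Adj a b → b ∈ S) : v ∈ S := by
  obtain ⟨p⟩ := h
  induction p with
  | nil => exact hu
  | cons h p ih => exact ih (hS _ hu _ h)

/-- Were `x` incident with one edge of color `c` only, all of `T` would have degree at most one in
`c`, and the class would be a spanning star. Its center can be neither in `T` nor outside. -/
lemma IsMCColoring.two_le_ncard_neighborSet {D : Type*} [Finite V] {G : SimpleGraph V} {k : ℕ}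
    {Γ : G.edgeSet → D} (hΓ : IsMCColoring k Γ) (hk : 2 ≤ k) {T : Set V}
    (hT : ∀ u ∈ T, (G.neighborSet u).ncard = k) (hcover : ∀ u v, G.Adj u v → u ∈ T ∨ v ∈ T)
    (hcard : 2 < T.ncard) {x y : V} {c : D} (hxT : x ∈ T) (hxy : (colorGraph Γ c).Adj x y) :
    2 ≤ ((colorGraph Γ c).neighborSet x).ncard := by
  have hpos : 0 < ((colorGraph Γ c).neighborSet x).ncard :=
    (Set.ncard_pos (Set.toFinite _)).2 ⟨y, hxy⟩
  by_contra! hlt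
  have hone : ∀ z ∈ T, ((colorGraph Γ c).neighborSet z).ncard ≤ 1 := by
    intro z hz
    by_cases hzx : z = x
    · rw [hzx]; omega
    · have := hΓ.ncard_neighborSet_le hzx (hT z hz) c
      omega
  have huniq : ∀ z ∈ T, ∀ a b, (colorGraph Γ c).Adj z a → (colorGraph Γ c).Adj z b → a = b :=
    fun z hz a b ha hb => (Set.ncard_le_one (Set.toFinite _)).1 (hone z hz) a ha b hb
  -- The star at `y` is closed under `c`-adjacency, and `c` reaches every vertex from `x`.
  have hall : ∀ z, z = y ∨ (colorGraph Γ c).Adj z y := by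
    intro z
    refine (hΓ.reachable_colorGraph (hT x hxT) hxy z).mem_of_adj_closed
      (S := {z | z = y ∨ (colorGraph Γ c).Adj z y}) (Or.inr hxy) ?_
    rintro a (rfl | ha) b hb
    · exact Or.inr hb.symm
    · by_cases haT : a ∈ T
      · exact Or.inl (huniq a haT b y hb ha)
      · have hyT := (hcover a y (colorGraph_le Γ c ha)).resolve_left haT
        have := huniq y hyT a x ha.symm hxy.symm
        exact absurd (this ▸ hxT) haT
  by_cases hyT : y ∈ T
  · have hsub : T ⊆ {y, x} := by
      intro z hz
      rcases hall z with rfl | h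
      · simp
      · exact Or.inr (huniq y hyT z x h.symm hxy.symm)
    have := Set.ncard_le_ncard hsub (Set.toFinite _)
    have := Set.ncard_insert_le y {x}
    rw [Set.ncard_singleton] at this
    omega
  · have hxy' : x ≠ y := fun h => hyT (h ▸ hxT)
    -- Every color at `x` also occurs at `y`, where only `c` occurs. So all `k` edges at `x` have
    -- color `c`.
    have hsub : G.neighborSet x ⊆ (colorGraph Γ c).neighborSet x := by
      intro z hz
      have hz' : (colorGraph Γ (Γ ⟨s(x, z), hz⟩)).Adj x z := adj_colorGraph.2 ⟨hz, rfl⟩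
      have h1 := hΓ.ncard_neighborSet_le hxy' (hT x hxT) (Γ ⟨s(x, z), hz⟩)
      have h2 : 0 < ((colorGraph Γ (Γ ⟨s(x, z), hz⟩)).neighborSet x).ncard :=
        (Set.ncard_pos (Set.toFinite _)).2 ⟨z, hz'⟩
      obtain ⟨t, ht⟩ := (Set.ncard_pos (Set.toFinite _)).1 (h2.trans_le h1)
      obtain ⟨g1, e1⟩ := adj_colorGraph.1 ht
      obtain ⟨g2, e2⟩ := adj_colorGraph.1 ((hall t).resolve_left g1.ne.symm).symm
      rw [← e2, e1]
      exact hz'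
    have h3 := Set.ncard_le_ncard hsub (Set.toFinite _)
    rw [hT x hxT] at h3
    omega

/-- Every color takes at least two of the `k` edges at a single vertex of `T`. -/
lemma IsMCColoring.two_mul_le {G : SimpleGraph V} [Finite V] {k r : ℕ}
    {Γ : G.edgeSet → Fin r} (hΓ : IsMCColoring k Γ) (hsurj : Function.Surjective Γ) (hk : 2 ≤ k)
    {T : Set V} (hT : ∀ u ∈ T, (G.neighborSet u).ncard = k)
    (hcover : ∀ u v, G.Adj u v → u ∈ T ∨ v ∈ T) (hcard : 2 < T.ncard) : 2 * r ≤ k := by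
  classical
  have := Fintype.ofFinite V
  obtain ⟨x, hx⟩ : T.Nonempty := Set.nonempty_of_ncard_ne_zero (by omega)
  have hdeg : ∀ c, 2 ≤ ((colorGraph Γ c).neighborSet x).ncard := by
    intro c
    obtain ⟨⟨e, he⟩, hc⟩ := hsurj c
    obtain ⟨a, b, haT, hab⟩ : ∃ a b, a ∈ T ∧ (colorGraph Γ c).Adj a b := by
      induction e with
      | _ a b =>
      have hab : (colorGraph Γ c).Adj a b := adj_colorGraph.2 ⟨he, hc⟩
      rcases hcover a b he with h | h
      · exact ⟨a, b, h, hab⟩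
      · exact ⟨b, a, h, hab.symm⟩
    have h2 := hΓ.two_le_ncard_neighborSet hk hT hcover hcard haT hab
    by_cases hax : a = x
    · rwa [← hax]
    · exact h2.trans (hΓ.ncard_neighborSet_le hax (hT a haT) c)
  have hinj : Function.Injective fun p : Σ c, (colorGraph Γ c).neighborSet x =>
      (⟨p.2.1, colorGraph_le Γ p.1 p.2.2⟩ : G.neighborSet x) := by
    rintro ⟨c, w, hw⟩ ⟨c', w', hw'⟩ h
    have hww : w = w' := congrArg Subtype.val h
    subst hww
    obtain ⟨_, rfl⟩ := adj_colorGraph.1 hw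
    obtain ⟨_, rfl⟩ := adj_colorGraph.1 hw'
    rfl
  have h1 := Nat.card_le_card_of_injective _ hinj
  rw [Nat.card_sigma, Nat.card_coe_set_eq, hT x hx] at h1
  have h2 : ∑ _c : Fin r, 2 ≤ ∑ c, Nat.card ((colorGraph Γ c).neighborSet x) :=
    Finset.sum_le_sum fun c _ => by rw [Nat.card_coe_set_eq]; exact hdeg c
  rw [Finset.sum_const, Finset.card_univ, Fintype.card_fin, smul_eq_mul] at h2
  omega

/-- When every edge has an end of degree `k`, a `k`-edge-connected spanning subgraph is everything. -/
lemma IsEdgeConnected.eq_of_le [Finite V] [Nontrivial V] {G H : SimpleGraph V} {k : ℕ} {T : Set V}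
    (hT : ∀ u ∈ T, (G.neighborSet u).ncard = k) (hcover : ∀ u v, G.Adj u v → u ∈ T ∨ v ∈ T)
    (hle : H ≤ G) (hH : H.IsEdgeConnected k) : H = G := by
  classical
  have := Fintype.ofFinite V
  have key : ∀ u ∈ T, ∀ v, G.Adj u v → H.Adj u v := by
    intro u hu v huv
    have hsub : H.neighborSet u ⊆ G.neighborSet u := fun w hw => hle hw
    have h1 : k ≤ (H.neighborSet u).ncard := by
      have := hH.le_degree (u := u)
      rwa [← card_neighborSet_eq_degree, ← Nat.card_eq_fintype_card, Nat.card_coe_set_eq] at this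
    have h2 := Set.eq_of_subset_of_ncard_le hsub (by rw [hT u hu]; exact h1) (Set.toFinite _)
    have h3 : v ∈ G.neighborSet u := huv
    rw [← h2] at h3
    exact h3
  refine le_antisymm hle fun u v huv => ?_
  rcases hcover u v huv with h | h
  · exact key u h v huv
  · exact (key v h u huv.symm).symm

theorem mcFormula_of_degree [Finite V] {G : SimpleGraph V} {k r : ℕ} {T : Set V} (hk : 2 ≤ k)
    (hT : ∀ u ∈ T, (G.neighborSet u).ncard = k) (hcover : ∀ u v, G.Adj u v → u ∈ T ∨ v ∈ T)
    (hcard : 2 < T.ncard) (hr : r ∈ mcColorCounts G k) (hrk : k / 2 ≤ r) :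
    G.IsEdgeConnected k ∧ MCFormula G k ∧ mc G k = k / 2 := by
  have hub : ∀ r ∈ mcColorCounts G k, r ≤ k / 2 := by
    rintro r ⟨Γ, hsurj, hΓ⟩
    have := hΓ.two_mul_le hsurj hk hT hcover hcard
    omega
  have hmc : mc G k = k / 2 := mc_eq_of_isGreatest
    ⟨le_antisymm (hub r hr) hrk ▸ hr, fun r hr => hub r hr⟩
  obtain ⟨Γ, -, hΓ⟩ := hr
  have : Nontrivial V := by
    obtain ⟨a, b, -, -, h⟩ := (Set.one_lt_ncard_iff (Set.toFinite T)).1 (by omega)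
    exact ⟨a, b, h⟩
  refine ⟨hΓ.isEdgeConnected, fun H hH => ?_, hmc⟩
  rw [hH.1.2.1.eq_of_le hT hcover hH.1.1, hmc]
  simp

/-! ### Hamiltonian cycles as color classes -/

/-- The vertices of a cycle are `2`-edge-reachable. -/
lemma isEdgeReachable_two_of_cycle {H : SimpleGraph V} {f : ℕ → V} {m : ℕ} (hm : 3 ≤ m)
    (hf : f m = f 0) (hinj : ∀ i j, i < m → j < m → f i = f j → i = j)
    (hadj : ∀ i < m, H.Adj (f i) (f (i + 1))) {i : ℕ} (hi : i < m) :
    H.IsEdgeReachable 2 (f 0) (f i) := by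
  have hinj' : ∀ i j, i < m → j < m → f i = f (j + 1) → i = j + 1 ∨ (i = 0 ∧ j + 1 = m) := by
    intro i j hi hj h
    by_cases hjm : j + 1 = m
    · rw [hjm, hf] at h
      exact Or.inr ⟨hinj i 0 hi (by omega) h, hjm⟩
    · exact Or.inl (hinj i (j + 1) hi (by omega) h)
  have hedge : ∀ i j, i < m → j < m → s(f i, f (i + 1)) = s(f j, f (j + 1)) → i = j := by
    intro i j hi hj h
    rcases Sym2.eq_iff.1 h with ⟨h, -⟩ | ⟨h1, h2⟩
    · exact hinj i j hi hj h
    · have := hinj' i j hi hj h1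
      have := hinj' j i hj hi h2.symm
      omega
  rw [isEdgeReachable_two]
  intro e
  -- `t` is the position of the deleted edge, or `m` if it is not on the cycle; vertices up to `t`
  -- are reached forwards, the later ones backwards.
  obtain ⟨t, ht⟩ : ∃ t, ∀ j < m, j ≠ t → s(f j, f (j + 1)) ≠ e := by
    by_cases h : ∃ t < m, s(f t, f (t + 1)) = e
    · obtain ⟨t, htm, rfl⟩ := h
      exact ⟨t, fun j hj hjt h => hjt (hedge j t hj htm h)⟩
    · push Not at h
      exact ⟨m, fun j hj _ => h j hj⟩
  have hstep : ∀ j < m, j ≠ t → (H.deleteEdges {e}).Reachable (f j) (f (j + 1)) := fun j hj hjt =>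
    Adj.reachable (deleteEdges_adj.2 ⟨hadj j hj, ht j hj hjt⟩)
  have hup : ∀ j ≤ m, j ≤ t → (H.deleteEdges {e}).Reachable (f 0) (f j) := by
    intro j
    induction j with
    | zero => intros; exact .rfl
    | succ j ih => exact fun h1 h2 => (ih (by omega) (by omega)).trans (hstep j (by omega) (by omega))
  have hdown : ∀ d ≤ m, t < m - d → (H.deleteEdges {e}).Reachable (f (m - d)) (f 0) := by
    intro d
    induction d with
    | zero =>
      intros
      rw [Nat.sub_zero, hf]
    | succ d ih =>
      intro h1 h2
      have h3 := hstep (m - (d + 1)) (by omega) (by omega)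
      rw [show m - (d + 1) + 1 = m - d by omega] at h3
      exact h3.trans (ih (by omega) (by omega))
  by_cases hit : i ≤ t
  · exact hup i hi.le hit
  · have := hdown (m - i) (by omega) (by omega)
    rw [show m - (m - i) = i by omega] at this
    exact this.symm

/-- Deleting one edge spoils at most one of the two links at `w`. -/
lemma IsEdgeReachable.of_two_neighbors {H : SimpleGraph V} {w x y z : V}
    (hx : H.IsEdgeReachable 2 z x) (hy : H.IsEdgeReachable 2 z y) (hxy : x ≠ y)
    (hwx : H.Adj w x) (hwy : H.Adj w y) : H.IsEdgeReachable 2 z w := by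
  rw [isEdgeReachable_two] at *
  intro e
  by_cases he : s(w, x) = e
  · refine (hy e).trans (Adj.reachable (deleteEdges_adj.2 ⟨hwy, ?_⟩)).symm
    rintro rfl
    exact hxy (Sym2.congr_right.1 he)
  · exact (hx e).trans (Adj.reachable (deleteEdges_adj.2 ⟨hwx, he⟩)).symm

/-- The edge-coloring given by a symmetric function of the ends. -/
def symmColoring (G : SimpleGraph V) (col : V → V → ℕ) (hcol : ∀ x y, col x y = col y x)
    (e : G.edgeSet) : ℕ :=
  Sym2.lift ⟨col, hcol⟩ e.1

lemma adj_colorGraph_symmColoring {G : SimpleGraph V} {col : V → V → ℕ}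
    {hcol : ∀ x y, col x y = col y x} {c : ℕ} {x y : V} :
    (colorGraph (symmColoring G col hcol) c).Adj x y ↔ G.Adj x y ∧ col x y = c := by
  rw [adj_colorGraph]
  exact ⟨fun ⟨h, h'⟩ => ⟨h, h'⟩, fun ⟨h, h'⟩ => ⟨h, h'⟩⟩

/-- Colors from `m` on may occur too, hence only `m ≤ r`; the upper bound on `r` gives equality
where it is applied. -/
lemma exists_mem_mcColorCounts [Finite V] [Nontrivial V] {G : SimpleGraph V} {m : ℕ}
    {Γ : G.edgeSet → ℕ} (h : ∀ c < m, (colorGraph Γ c).IsEdgeConnected 2) :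
    ∃ r ∈ mcColorCounts G (2 * m), m ≤ r := by
  classical
  have hmc : IsMCColoring (2 * m) Γ :=
    isMCColoring_of_colorGraph (fun c : Fin m => c.1) Fin.val_injective fun c => h c c.2
  have hmc' : IsMCColoring (2 * m) (Set.rangeFactorization Γ) := by
    intro u v huv
    obtain ⟨P, hP, hd⟩ := hmc u v huv
    exact ⟨P, fun i e f he hf => Subtype.ext (hP i e f he hf), hd⟩
  refine ⟨_, mem_mcColorCounts Set.rangeFactorization_surjective hmc', ?_⟩
  have hmem : ∀ c : Fin m, c.1 ∈ Set.range Γ := by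
    intro c
    obtain ⟨u, v, huv⟩ := exists_pair_ne V
    obtain ⟨p⟩ := (h c c.2).preconnected (by norm_num) u v
    cases p with
    | nil => exact absurd rfl huv
    | cons h p =>
      obtain ⟨_, h'⟩ := adj_colorGraph.1 h
      exact ⟨_, h'⟩
  have := Nat.card_le_card_of_injective (fun c : Fin m => (⟨c.1, hmem c⟩ : Set.range Γ))
    fun a b hab => Fin.ext (congrArg Subtype.val hab)
  rwa [Nat.card_fin] at this

/-! ### The complete graph on an odd number of vertices -/

/-- The color of the pair `x, y` in the zigzag decomposition of `K_{2n+1}` into cycles, `2 * n`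
being the hub. -/
def zigzagColor (n x y : ℕ) : ℕ :=
  if x = 2 * n then (if y < n then y else y - n)
  else if y = 2 * n then (if x < n then x else x - n)
  else if x + y < 2 * n then (x + y) / 2 else (x + y - 2 * n) / 2

/-- The cycle of color `c` in the zigzag decomposition. -/
def zigzag (n c s : ℕ) : ℕ :=
  if s = 0 then 2 * n
  else if 2 * n < s then 2 * n
  else if s % 2 = 0 then c + s / 2
  else if s / 2 ≤ c then c - s / 2 else c + 2 * n - s / 2

lemma zigzagColor_comm (n x y : ℕ) : zigzagColor n x y = zigzagColor n y x := by
  unfold zigzagColor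
  split_ifs <;> first | contradiction | omega

lemma zigzag_lt {n c : ℕ} (hc : c < n) (s : ℕ) : zigzag n c s < 2 * n + 1 := by
  unfold zigzag
  split_ifs <;> first | contradiction | omega

lemma zigzag_inj {n c i j : ℕ} (hc : c < n) (hi : i < 2 * n + 1) (hj : j < 2 * n + 1)
    (h : zigzag n c i = zigzag n c j) : i = j := by
  unfold zigzag at h
  split_ifs at h <;> omega

lemma zigzag_ne_succ {n c i : ℕ} (hc : c < n) (hi : i < 2 * n + 1) :
    zigzag n c i ≠ zigzag n c (i + 1) := by
  unfold zigzag
  split_ifs <;> first | contradiction | omega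

/-- The cycle runs hub, `c`, `c + 1`, `c - 1`, `c + 2`, ... modulo `2n`, ending at `c + n`.
Consecutive labels off the hub add up to `2c` or `2c + 1` modulo `2n`, so halving recovers `c`. -/
lemma zigzagColor_zigzag {n c i : ℕ} (hc : c < n) (hi : i < 2 * n + 1) :
    zigzagColor n (zigzag n c i) (zigzag n c (i + 1)) = c := by
  rcases Nat.eq_zero_or_pos i with rfl | hpos
  · have h1 : zigzag n c 0 = 2 * n := rfl
    have h2 : zigzag n c (0 + 1) = c := by
      unfold zigzag
      split_ifs <;> first | contradiction | omega
    rw [h1, h2, zigzagColor, if_pos rfl, if_pos hc]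
  rcases Nat.lt_or_ge i (2 * n) with hlt | hge
  · have h1 : zigzag n c i < 2 * n := by
      unfold zigzag
      split_ifs <;> first | contradiction | omega
    have h2 : zigzag n c (i + 1) < 2 * n := by
      unfold zigzag
      split_ifs <;> first | contradiction | omega
    have h3 : ∃ d, d < 2 ∧ (zigzag n c i + zigzag n c (i + 1) = 2 * c + d ∨
        zigzag n c i + zigzag n c (i + 1) = 2 * c + d + 2 * n) := by
      refine ⟨i % 2, by omega, ?_⟩
      unfold zigzag
      split_ifs <;> first | contradiction | omega
    obtain ⟨d, hd, h3⟩ := h3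
    unfold zigzagColor
    split_ifs <;> first | contradiction | omega
  · obtain rfl : i = 2 * n := by omega
    have h1 : zigzag n c (2 * n) = c + n := by
      unfold zigzag
      split_ifs <;> first | contradiction | omega
    have h2 : zigzag n c (2 * n + 1) = 2 * n := by
      unfold zigzag
      split_ifs <;> first | contradiction | omega
    rw [h1, h2, zigzagColor]
    split_ifs <;> first | contradiction | omega

lemma exists_zigzag {n c x : ℕ} (hc : c < n) (hx : x < 2 * n + 1) :
    ∃ i < 2 * n + 1, zigzag n c i = x := by
  rcases Nat.lt_or_ge x (2 * n) with hlt | hge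
  · rcases Nat.lt_or_ge c x with h1 | h1
    · rcases Nat.lt_or_ge (c + n) x with h2 | h2
      · refine ⟨2 * (c + 2 * n - x) + 1, by omega, ?_⟩
        unfold zigzag
        split_ifs <;> first | contradiction | omega
      · refine ⟨2 * (x - c), by omega, ?_⟩
        unfold zigzag
        split_ifs <;> first | contradiction | omega
    · refine ⟨2 * (c - x) + 1, by omega, ?_⟩
      unfold zigzag
      split_ifs <;> first | contradiction | omega
  · exact ⟨0, by omega, by unfold zigzag; rw [if_pos rfl]; omega⟩

theorem mcFormula_completeGraph {n : ℕ} (hn : 2 ≤ n) :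
    (completeGraph (Fin (2 * n + 1))).IsEdgeConnected (2 * n) ∧
      MCFormula (completeGraph (Fin (2 * n + 1))) (2 * n) ∧
      mc (completeGraph (Fin (2 * n + 1))) (2 * n) = n := by
  have : Nontrivial (Fin (2 * n + 1)) := Fin.nontrivial_iff_two_le.2 (by omega)
  obtain ⟨r, hr, hnr⟩ := exists_mem_mcColorCounts (m := n)
    (Γ := symmColoring (completeGraph (Fin (2 * n + 1))) (fun x y => zigzagColor n x y)
      fun x y => zigzagColor_comm n x y) (by
    intro c hc
    have hcyc : ∀ x, (colorGraph (symmColoring (completeGraph (Fin (2 * n + 1)))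
        (fun x y => zigzagColor n x y) fun x y => zigzagColor_comm n x y) c).IsEdgeReachable 2
        ⟨zigzag n c 0, zigzag_lt hc 0⟩ x := by
      intro x
      obtain ⟨i, hi, hix⟩ := exists_zigzag hc x.2
      obtain rfl : ⟨zigzag n c i, zigzag_lt hc i⟩ = x := Fin.ext hix
      refine isEdgeReachable_two_of_cycle
        (f := fun i => (⟨zigzag n c i, zigzag_lt hc i⟩ : Fin (2 * n + 1)))
        (m := 2 * n + 1) (by omega) ?_ ?_ ?_ hi
      · refine Fin.ext ?_
        simp [zigzag]
      · exact fun i j hi hj h => zigzag_inj hc hi hj (Fin.mk.inj h)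
      · intro i hi
        refine adj_colorGraph_symmColoring.2 ⟨fun h => ?_, zigzagColor_zigzag hc hi⟩
        exact zigzag_ne_succ hc hi (Fin.mk.inj h)
    exact fun x y => (hcyc x).symm.trans (hcyc y))
  have key := mcFormula_of_degree (G := completeGraph (Fin (2 * n + 1))) (k := 2 * n)
    (T := Set.univ) (by omega) (fun u _ => ?_) (fun u v _ => Or.inl trivial) ?_ hr (by omega)
  · rwa [Nat.mul_div_cancel_left n (by norm_num)] at key
  · have : (completeGraph (Fin (2 * n + 1))).neighborSet u = {u}ᶜ := by
      ext v
      simp [completeGraph, eq_comm]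
    rw [this, Set.ncard_compl, Set.ncard_singleton, Nat.card_fin]
    rfl
  · rw [Set.ncard_univ, Nat.card_fin]
    omega

/-! ### Complete bipartite graphs -/

lemma ncard_neighborSet_completeBipartiteGraph_inr {k n : ℕ} (b : Fin n) :
    ((completeBipartiteGraph (Fin k) (Fin n)).neighborSet (Sum.inr b)).ncard = k := by
  have : (completeBipartiteGraph (Fin k) (Fin n)).neighborSet (Sum.inr b) = Set.range Sum.inl := by
    ext v
    cases v <;> simp
  rw [this, ← Set.image_univ, Set.ncard_image_of_injective _ Sum.inl_injective, Set.ncard_univ,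
    Nat.card_fin]

theorem mcFormula_completeBipartiteGraph {k n r : ℕ} (hk : 3 ≤ k) (hn : k ≤ n)
    (hr : r ∈ mcColorCounts (completeBipartiteGraph (Fin k) (Fin n)) k) (hrk : k / 2 ≤ r) :
    (completeBipartiteGraph (Fin k) (Fin n)).IsEdgeConnected k ∧
      MCFormula (completeBipartiteGraph (Fin k) (Fin n)) k ∧
      mc (completeBipartiteGraph (Fin k) (Fin n)) k = k / 2 := by
  refine mcFormula_of_degree (T := Set.range Sum.inr) (by omega) ?_ ?_ ?_ hr hrk
  · rintro - ⟨b, rfl⟩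
    exact ncard_neighborSet_completeBipartiteGraph_inr b
  · rintro (a | a) (b | b) h <;> simp at h ⊢
  · rw [← Set.image_univ, Set.ncard_image_of_injective _ Sum.inr_injective, Set.ncard_univ,
      Nat.card_fin]
    omega

/-- The color of the edge between the `i`-th vertex on the left and the `j`-th on the right. -/
def bipartiteColor (k i j : ℕ) : ℕ :=
  if i + (if j < k then j else 0) < k then (i + (if j < k then j else 0)) / 2
  else (i + (if j < k then j else 0) - k) / 2

/-- The coloring of `K_{k,n}` by `bipartiteColor`, as a symmetric function. -/
def sumColor (k n : ℕ) : Fin k ⊕ Fin n → Fin k ⊕ Fin n → ℕ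
  | .inl i, .inr j => bipartiteColor k i j
  | .inr j, .inl i => bipartiteColor k i j
  | _, _ => 0

lemma sumColor_comm (k n : ℕ) (x y : Fin k ⊕ Fin n) : sumColor k n x y = sumColor k n y x := by
  cases x <;> cases y <;> rfl

/-- The left neighbor, for color `c`, shared by the right vertices `t` and `t + 1`. -/
def leftVertex (k c t : ℕ) : ℕ := if t ≤ 2 * c then 2 * c - t else 2 * c + k - t

lemma leftVertex_lt {k c : ℕ} (hc : 2 * c + 1 < k) (t : ℕ) : leftVertex k c t < k := by
  unfold leftVertex
  split_ifs <;> omega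

lemma bipartiteColor_leftVertex {k c t : ℕ} (hc : 2 * c + 1 < k) (ht : t < k) :
    bipartiteColor k (leftVertex k c t) t = c := by
  unfold bipartiteColor leftVertex
  split_ifs <;> omega

/-- Moving to the next right vertex raises the index sum from `2c` to `2c + 1` modulo `k`, without
changing its half. -/
lemma bipartiteColor_leftVertex_succ {k c t : ℕ} (hk : Even k) (hc : 2 * c + 1 < k) (ht : t < k) :
    bipartiteColor k (leftVertex k c t) (if t + 1 < k then t + 1 else 0) = c := by
  obtain ⟨m, rfl⟩ := hk
  unfold bipartiteColor leftVertex
  split_ifs <;> omega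

/-- Right vertices beyond the first `k` imitate vertex `0`, so each has two edges of color `c`, to
the left vertices `2c` and `2c + 1`. -/
lemma bipartiteColor_of_le {k c j d : ℕ} (hc : 2 * c + 1 < k) (hj : k ≤ j) (hd : d < 2) :
    bipartiteColor k (2 * c + d) j = c := by
  unfold bipartiteColor
  split_ifs <;> omega

/-- The cycle of color `c` through all left vertices and the first `k` right vertices. -/
def bipartiteCycle {k n c : ℕ} (hc : 2 * c + 1 < k) (hn : k ≤ n) (s : ℕ) : Fin k ⊕ Fin n :=
  if s % 2 = 0 then .inr ⟨if s / 2 < k then s / 2 else 0, by split_ifs <;> omega⟩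
  else .inl ⟨leftVertex k c (s / 2), leftVertex_lt hc _⟩

lemma bipartiteCycle_even {k n c : ℕ} (hc : 2 * c + 1 < k) (hn : k ≤ n) (t : ℕ) :
    bipartiteCycle hc hn (2 * t) = .inr ⟨if t < k then t else 0, by split_ifs <;> omega⟩ := by
  simp [bipartiteCycle]

lemma bipartiteCycle_odd {k n c : ℕ} (hc : 2 * c + 1 < k) (hn : k ≤ n) (t : ℕ) :
    bipartiteCycle hc hn (2 * t + 1) = .inl ⟨leftVertex k c t, leftVertex_lt hc _⟩ := by
  have h1 : (2 * t + 1) % 2 ≠ 0 := by omega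
  have h2 : (2 * t + 1) / 2 = t := by omega
  simp only [bipartiteCycle, if_neg h1, h2]

lemma bipartiteCycle_inj {k n c : ℕ} (hc : 2 * c + 1 < k) (hn : k ≤ n) {i j : ℕ}
    (hi : i < 2 * k) (hj : j < 2 * k) (h : bipartiteCycle hc hn i = bipartiteCycle hc hn j) :
    i = j := by
  obtain ⟨s, rfl | rfl⟩ := Nat.even_or_odd' i <;> obtain ⟨t, rfl | rfl⟩ := Nat.even_or_odd' j
  · rw [bipartiteCycle_even, bipartiteCycle_even] at h
    have h1 := Fin.mk.inj (Sum.inr_injective h)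
    rw [if_pos (by omega), if_pos (by omega)] at h1
    omega
  · rw [bipartiteCycle_even, bipartiteCycle_odd] at h
    simp at h
  · rw [bipartiteCycle_even, bipartiteCycle_odd] at h
    simp at h
  · rw [bipartiteCycle_odd, bipartiteCycle_odd] at h
    have h1 := Fin.mk.inj (Sum.inl_injective h)
    unfold leftVertex at h1
    split_ifs at h1 <;> omega

lemma isEdgeConnected_two_colorGraph_sumColor {k n c : ℕ} (hk : Even k) (hn : k ≤ n)
    (hc : 2 * c + 1 < k) :
    (colorGraph (symmColoring (completeBipartiteGraph (Fin k) (Fin n)) (sumColor k n)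
      (sumColor_comm k n)) c).IsEdgeConnected 2 := by
  have hadj : ∀ (i : Fin k) (j : Fin n), bipartiteColor k i j = c →
      (colorGraph (symmColoring (completeBipartiteGraph (Fin k) (Fin n)) (sumColor k n)
      (sumColor_comm k n)) c).Adj (.inl i) (.inr j) := fun i j h =>
    adj_colorGraph_symmColoring.2 ⟨by simp, h⟩
  generalize colorGraph (symmColoring (completeBipartiteGraph (Fin k) (Fin n)) (sumColor k n)
      (sumColor_comm k n)) c = H at hadj ⊢
  have hcyc : ∀ i < 2 * k, H.IsEdgeReachable 2 (bipartiteCycle hc hn 0)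
      (bipartiteCycle hc hn i) := by
    intro i hi
    refine isEdgeReachable_two_of_cycle (m := 2 * k) (by omega) ?_ ?_ ?_ hi
    · rw [bipartiteCycle_even]
      simp [bipartiteCycle]
    · exact fun i j hi hj h => bipartiteCycle_inj hc hn hi hj h
    · intro i hi
      obtain ⟨t, rfl | rfl⟩ := Nat.even_or_odd' i
      · rw [bipartiteCycle_even, bipartiteCycle_odd]
        refine (hadj _ _ ?_).symm
        simp only
        rw [if_pos (by omega)]
        exact bipartiteColor_leftVertex hc (by omega)
      · rw [show 2 * t + 1 + 1 = 2 * (t + 1) by ring, bipartiteCycle_even, bipartiteCycle_odd]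
        exact hadj _ _ (bipartiteColor_leftVertex_succ hk hc (by omega))
  have hleft : ∀ a : Fin k, H.IsEdgeReachable 2 (bipartiteCycle hc hn 0) (.inl a) := by
    intro a
    obtain ⟨t, ht, hta⟩ : ∃ t < k, leftVertex k c t = a := by
      have := a.2
      refine ⟨if a.1 ≤ 2 * c then 2 * c - a else 2 * c + k - a, by split_ifs <;> omega, ?_⟩
      unfold leftVertex
      split_ifs <;> omega
    have := hcyc (2 * t + 1) (by omega)
    rw [bipartiteCycle_odd] at this
    convert this using 2
    exact Fin.ext hta.symm
  have hall : ∀ x, H.IsEdgeReachable 2 (bipartiteCycle hc hn 0) x := by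
    rintro (a | b)
    · exact hleft a
    · rcases Nat.lt_or_ge b k with hb | hb
      · have := hcyc (2 * b) (by omega)
        rw [bipartiteCycle_even] at this
        convert this using 2
        exact Fin.ext (if_pos hb).symm
      · refine (hleft ⟨2 * c, by omega⟩).of_two_neighbors (hleft ⟨2 * c + 1, hc⟩) ?_
          (hadj _ _ (bipartiteColor_of_le hc hb (d := 0) (by norm_num))).symm
          (hadj _ _ (bipartiteColor_of_le hc hb (d := 1) (by norm_num))).symm
        simp
  exact fun x y => (hall x).symm.trans (hall y)

lemma exists_mem_mcColorCounts_completeBipartiteGraph {k n : ℕ} (hk : Even k) (hk0 : 2 ≤ k)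
    (hn : k ≤ n) : ∃ r ∈ mcColorCounts (completeBipartiteGraph (Fin k) (Fin n)) k, k / 2 ≤ r := by
  have : Nontrivial (Fin k ⊕ Fin n) :=
    ⟨.inl ⟨0, by omega⟩, .inr ⟨0, by omega⟩, by simp⟩
  have h := exists_mem_mcColorCounts (m := k / 2) fun c hc =>
    isEdgeConnected_two_colorGraph_sumColor (n := n) hk hn (c := c) (by omega)
  rwa [Nat.two_mul_div_two_of_even hk] at h

lemma one_mem_mcColorCounts {G : SimpleGraph V} {k : ℕ} [Nonempty G.edgeSet]
    (h : ∀ u v, u ≠ v → ∃ P : Fin k → G.Walk u v,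
      ∀ i j, i ≠ j → List.Disjoint (P i).edges (P j).edges) : 1 ∈ mcColorCounts G k := by
  classical
  refine ⟨fun _ => 0, fun c => ⟨Classical.arbitrary _, Subsingleton.elim _ _⟩, fun u v huv => ?_⟩
  obtain ⟨P, hP⟩ := h u v huv
  exact ⟨fun i => (P i).toPath, fun _ _ _ _ _ => rfl, fun i j hij e he he' =>
    hP i j hij (Walk.edges_toPath_subset_edges _ he) (Walk.edges_toPath_subset_edges _ he')⟩

lemma exists_disjoint_walks_completeBipartiteGraph {k n : ℕ} (hn : k ≤ n) (u v : Fin k ⊕ Fin n)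
    (huv : u ≠ v) : ∃ P : Fin k → (completeBipartiteGraph (Fin k) (Fin n)).Walk u v,
      ∀ i j, i ≠ j → List.Disjoint (P i).edges (P j).edges := by
  have hadj : ∀ a b, (completeBipartiteGraph (Fin k) (Fin n)).Adj (.inl a) (.inr b) := by simp
  have hlr : ∀ a b, ∃ P : Fin k → (completeBipartiteGraph (Fin k) (Fin n)).Walk (.inl a) (.inr b),
      ∀ i j, i ≠ j → List.Disjoint (P i).edges (P j).edges := by
    intro a b
    -- The walks are `a, σ i, i, b`. The condition `σ a = b` reserves the edge `ab` for `i = a`,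
    -- where the walk merely retraces that edge.
    obtain ⟨σ, hσ, hσa⟩ : ∃ σ : Fin k → Fin n, Function.Injective σ ∧ σ a = b :=
      ⟨fun i => Equiv.swap (Fin.castLE hn a) b (Fin.castLE hn i),
        (Equiv.injective _).comp (Fin.castLE_injective hn), by simp⟩
    refine ⟨fun i => .cons (hadj a (σ i)) (.cons (hadj i (σ i)).symm (.cons (hadj i b) .nil)),
      fun i j hij => ?_⟩
    have h1 : σ i ≠ σ j := fun h => hij (hσ h)
    have h2 : σ i = b → i = a := fun h => hσ (h.trans hσa.symm)
    have h3 : σ j = b → j = a := fun h => hσ (h.trans hσa.symm)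
    simp [List.Disjoint]
    grind
  rcases u with a | b <;> rcases v with a' | b'
  · have hne : a ≠ a' := fun h => huv (h ▸ rfl)
    refine ⟨fun i => .cons (hadj a (Fin.castLE hn i)) (.cons (hadj a' (Fin.castLE hn i)).symm .nil),
      fun i j hij => ?_⟩
    have h1 : Fin.castLE hn i ≠ Fin.castLE hn j := fun h => hij (Fin.castLE_injective hn h)
    simp [List.Disjoint]
    grind
  · exact hlr a b'
  · obtain ⟨P, hP⟩ := hlr a' b
    refine ⟨fun i => (P i).reverse, fun i j hij => ?_⟩
    simpa [List.Disjoint] using hP i j hij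
  · have hne : b ≠ b' := fun h => huv (h ▸ rfl)
    refine ⟨fun i => .cons (hadj i b).symm (.cons (hadj i b') .nil), fun i j hij => ?_⟩
    simp [List.Disjoint]
    grind

theorem one_mem_mcColorCounts_completeBipartiteGraph {k n : ℕ} (hk : 0 < k) (hn : k ≤ n) :
    1 ∈ mcColorCounts (completeBipartiteGraph (Fin k) (Fin n)) k := by
  have : Nonempty (completeBipartiteGraph (Fin k) (Fin n)).edgeSet :=
    ⟨s(.inl ⟨0, hk⟩, .inr ⟨0, by omega⟩), by simp⟩
  exact one_mem_mcColorCounts (exists_disjoint_walks_completeBipartiteGraph hn)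

end SimpleGraph

theorem theorem2p1 :
    (∀ (V : Type*) [Finite V] [Nontrivial V] (G : SimpleGraph V), G.IsEdgeConnected 2 →
      SimpleGraph.MCFormula G 2) ∧
    (∀ n : ℕ, 2 ≤ n →
      (SimpleGraph.completeGraph (Fin (2 * n + 1))).IsEdgeConnected (2 * n) ∧
      SimpleGraph.MCFormula (SimpleGraph.completeGraph (Fin (2 * n + 1))) (2 * n) ∧
      SimpleGraph.mc (SimpleGraph.completeGraph (Fin (2 * n + 1))) (2 * n) = n) ∧
    (∀ k n : ℕ, 4 ≤ k → Even k → k ≤ n →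
      (completeBipartiteGraph (Fin k) (Fin n)).IsEdgeConnected k ∧
      SimpleGraph.MCFormula (completeBipartiteGraph (Fin k) (Fin n)) k ∧
      SimpleGraph.mc (completeBipartiteGraph (Fin k) (Fin n)) k = k / 2) ∧
    (∀ n : ℕ, 3 ≤ n →
      (completeBipartiteGraph (Fin 3) (Fin n)).IsEdgeConnected 3 ∧
      SimpleGraph.MCFormula (completeBipartiteGraph (Fin 3) (Fin n)) 3 ∧
      SimpleGraph.mc (completeBipartiteGraph (Fin 3) (Fin n)) 3 = 1) := by
  refine ⟨fun V _ _ G hG => SimpleGraph.mcFormula_two hG,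
    fun n hn => SimpleGraph.mcFormula_completeGraph hn, fun k n hk hev hn => ?_, fun n hn => ?_⟩
  · obtain ⟨r, hr, hrk⟩ :=
      SimpleGraph.exists_mem_mcColorCounts_completeBipartiteGraph hev (by omega) hn
    exact SimpleGraph.mcFormula_completeBipartiteGraph (by omega) hn hr hrk
  · exact SimpleGraph.mcFormula_completeBipartiteGraph le_rfl hn
      (SimpleGraph.one_mem_mcColorCounts_completeBipartiteGraph (by norm_num) hn) (by norm_num)
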